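/- An effect algebra is a set $E$ with a partial operation $+$ and constants $0,1$ such that, for all $a,b,c\in E$: (i) $a+b$ is defined iff $b+a$ is, and then $a+b=b+a$; (ii) $a+b$ and $(a+b)+c$ are defined iff $b+c$ and $a+(b+c)$ are, and then $(a+b)+c=a+(b+c)$; (iii) there is a unique $a'\in E$ with $a+a'=1$; (iv) if $a+1$ is defined then $a=0$. It is partially ordered by $a\le b$ iff $a+c=b$ for some $c\in E$; it is a $\sigma$-lattice effect algebra if all countable suprema and infima exist in this order, and a complete lattice effect algebra if all suprema and infima exist. An observable on $E$ is a map $x$ from the Borel sets of $\mathbb R$ to $E$ such that $x(\mathbb R)=1$, $x(A\cup B)=x(A)+x(B)$ for disjoint $A,B$, and $x(\bigcup_i A_i)=\bigvee_i x(A_i)$ for every sequence $A_1\subseteq A_2\subseteq\cdots$. It is bounded if $x(C)=1$ for some compact $C$. Its spectrum $\sigma(x)$ is the least closed set $K$ with $x(K)=1$. Let $\mathcal O_b(E)$ be the set of bounded observables and $\mathcal{EO}(E)$ the set of observables with $\sigma(x)\subseteq[0,1]$. For $a\in E$, the question observable $q_a$ is the one with mass $a'$ at $0$ and mass $a$ at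 $1$ (so $q_a(A)$ is the sum of those of these masses whose points lie in $A$). The Olson order is defined by $x\preceq_s y$ iff $y((-\infty,t))\le x((-\infty,t))$ for all $t\in\mathbb R$. **Theorem.** Let $E$ be a $\sigma$-lattice effect algebra. (a) Under the Olson order, $\mathcal O_b(E)$ is a Dedekind $\sigma$-complete lattice: $\preceq_s$ is a partial order on it, any two elements have a supremum and an infimum, and every non-empty countable subset that is bounded below (above) in $\mathcal O_b(E)$ has an infimum (supremum) in $\mathcal O_b(E)$. For a non-empty countable $S\subseteq\mathcal O_b(E)$, an element $m\in \mathcal O_b(E)$ is the infimum of $S$ in $\mathcal O_b(E)$ if and only if $$m((-\infty,t))=\bigvee_{x\in S}x((-\infty,t))\quad\text{for all }t\in\mathbb R,$$ and $j\in \mathcal O_b(E)$ is the supremum of $S$ in $\mathcal O_b(E)$ if and only if $$j((-\infty,t))=\bigvee_{u<t}\ \bigwedge_{x\in S}x((-\infty,u))\quad\text{for all }t\in\mathbb R.$$ (b) Under the Olson order, $\mathcal{EO}(E)$ is a $\sigma$-complete lattice (all countable subsets have a supremum and an infimum), and it is a complete lattice if $E$ is a complete lattice effect algebra. In both cases $q_0$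 and $q_1$ are its bottom and top elements. -/

import Mathlib

open Set

/-- An effect algebra `(E; +, 0, 1)`.  The partial operation `+` is `padd`: the sum `a + b` is
defined with value `c` when `padd a b = some c`, and undefined when `padd a b = none`.
Equality in `Option E` thus says that one side is defined iff the other is, with equal values. -/
class EffectAlgebra (E : Type*) extends Zero E, One E where
  padd : E → E → Option E
  padd_comm : ∀ a b : E, padd a b = padd b a
  padd_assoc : ∀ a b c : E,
    (padd a b).bind (fun d => padd d c) = (padd b c).bind (fun d => padd a d)
  existsUnique_compl : ∀ a : E, ∃! b : E, padd a b = some 1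
  eq_zero_of_padd_one : ∀ a : E, (padd a 1).isSome → a = 0

namespace EffectAlgebra

variable {E : Type*} [EffectAlgebra E]

theorem padd_assoc_left {a b c d e : E} (h : padd a b = some d) (h2 : padd d c = some e) :
    ∃ f, padd b c = some f ∧ padd a f = some e := by
  have := padd_assoc a b c
  rw [h, Option.bind_some, h2] at this
  exact Option.bind_eq_some_iff.1 this.symm

theorem compl_unique {a b c : E} (h : padd a b = some 1) (h2 : padd a c = some 1) : b = c :=
  (existsUnique_compl a).unique h h2

theorem one_padd_zero : padd (1 : E) 0 = some 1 := by
  obtain ⟨b, hb, -⟩ := existsUnique_compl (1 : E)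
  have h0 : b = 0 := eq_zero_of_padd_one b (by rw [padd_comm, hb]; rfl)
  rwa [h0] at hb

theorem padd_zero (a : E) : padd a 0 = some a := by
  obtain ⟨b, hb, -⟩ := existsUnique_compl a
  have hb2 : padd b a = some 1 := by rw [padd_comm, hb]
  obtain ⟨d, hd, hd2⟩ := padd_assoc_left hb2 one_padd_zero
  rw [hd, compl_unique hd2 hb2]

theorem zero_padd (a : E) : padd 0 a = some a := by rw [padd_comm, padd_zero]

theorem padd_cancel {a b c e : E} (hb : padd a b = some e) (hc : padd a c = some e) : b = c := by
  obtain ⟨e', he, -⟩ := existsUnique_compl e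
  obtain ⟨f, hf, hf2⟩ := padd_assoc_left (by rw [padd_comm, hb] : padd b a = some e) he
  obtain ⟨g, hg, hg2⟩ := padd_assoc_left (by rw [padd_comm, hc] : padd c a = some e) he
  obtain rfl : f = g := by rw [hf] at hg; exact Option.some.inj hg
  exact compl_unique (a := f) (by rw [padd_comm, hf2]) (by rw [padd_comm, hg2])

theorem eq_zero_of_padd_eq_zero {a b : E} (h : padd a b = some 0) : b = 0 := by
  obtain ⟨f, hf, -⟩ := padd_assoc_left h (zero_padd (1 : E))
  exact eq_zero_of_padd_one b (by rw [hf]; rfl)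

/-- The order of an effect algebra: `a ≤ b` iff `a + c = b` for some `c`. -/
instance instPartialOrder : PartialOrder E where
  le a b := ∃ c, padd a c = some b
  le_refl a := ⟨0, padd_zero a⟩
  le_trans a b c := by
    rintro ⟨d, hd⟩ ⟨e, he⟩
    obtain ⟨f, -, hf⟩ := padd_assoc_left hd he
    exact ⟨f, hf⟩
  le_antisymm a b := by
    rintro ⟨d, hd⟩ ⟨e, he⟩
    obtain ⟨f, hf, hf2⟩ := padd_assoc_left hd he
    have h0 : f = 0 := padd_cancel hf2 (padd_zero a)
    rw [h0, padd_comm] at hf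
    rw [eq_zero_of_padd_eq_zero hf, padd_zero] at hd
    exact Option.some.inj hd

/-- The unique element `a'` with `a + a' = 1`. -/
noncomputable def compl (a : E) : E := (existsUnique_compl a).choose

theorem padd_compl (a : E) : padd a (compl a) = some 1 := (existsUnique_compl a).choose_spec.1

variable (E)

/-- `E` is a `σ`-lattice: every sequence of elements has a supremum and an infimum. -/
def IsSigmaLattice : Prop :=
  ∀ a : ℕ → E, (∃ s, IsLUB (range a) s) ∧ ∃ i, IsGLB (range a) i

end EffectAlgebra

open EffectAlgebra

/-- The Borel subsets of the real line. -/
abbrev BorelSet : Type := {A : Set ℝ // MeasurableSet A}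

/-- An observable on `E`. -/
@[ext]
structure Observable (E : Type*) [EffectAlgebra E] where
  toFun : BorelSet → E
  map_univ : toFun ⟨univ, MeasurableSet.univ⟩ = 1
  map_union : ∀ A B : BorelSet, Disjoint A.1 B.1 →
    padd (toFun A) (toFun B) = some (toFun ⟨A.1 ∪ B.1, A.2.union B.2⟩)
  map_iUnion : ∀ A : ℕ → BorelSet, (∀ i, (A i).1 ⊆ (A (i + 1)).1) →
    IsLUB (range fun i => toFun (A i)) (toFun ⟨⋃ i, (A i).1, MeasurableSet.iUnion fun i => (A i).2⟩)

namespace Observable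

variable {E : Type*} [EffectAlgebra E]

/-- The spectral resolution `t ↦ x((-∞, t))`. -/
def resolution (x : Observable E) (t : ℝ) : E := x.toFun ⟨Iio t, measurableSet_Iio⟩

/-- The Olson (spectral) order: `x ≤ y` iff `y((-∞, t)) ≤ x((-∞, t))` for all real `t`.
Antisymmetry is not built in. -/
instance instPreorder : Preorder (Observable E) where
  le x y := ∀ t : ℝ, y.resolution t ≤ x.resolution t
  le_refl _ _ := le_rfl
  le_trans _ _ _ h h2 t := (h2 t).trans (h t)

/-- `x` is bounded: `x(C) = 1` for some compact `C`. -/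
def IsBounded (x : Observable E) : Prop :=
  ∃ (C : Set ℝ) (hC : IsCompact C), x.toFun ⟨C, hC.measurableSet⟩ = 1

/-- The spectrum: the least closed set `K` with `x(K) = 1`, written as the intersection of all of
them. -/
def spectrum (x : Observable E) : Set ℝ :=
  ⋂₀ {K : Set ℝ | ∃ hK : IsClosed K, x.toFun ⟨K, hK.measurableSet⟩ = 1}

open Classical in
/-- The value at `A` of the observable with mass `a'` at the point `0` and mass `a` at the
point `1`, i.e. the sum of those of the two masses whose points lie in `A`. -/
noncomputable def questionFun (a : E) (A : Set ℝ) : E :=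
  if (0 : ℝ) ∈ A then (if (1 : ℝ) ∈ A then 1 else compl a)
  else (if (1 : ℝ) ∈ A then a else 0)

theorem questionFun_union (a : E) {A B : Set ℝ} (h : Disjoint A B) :
    padd (questionFun a A) (questionFun a B) = some (questionFun a (A ∪ B)) := by
  have h0 : (0 : ℝ) ∈ A → (0 : ℝ) ∉ B := fun hA hB => Set.disjoint_left.1 h hA hB
  have h1 : (1 : ℝ) ∈ A → (1 : ℝ) ∉ B := fun hA hB => Set.disjoint_left.1 h hA hB
  have hc : padd (compl a) a = some 1 := by rw [padd_comm, padd_compl]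
  by_cases a0 : (0 : ℝ) ∈ A <;> by_cases a1 : (1 : ℝ) ∈ A <;>
    by_cases b0 : (0 : ℝ) ∈ B <;> by_cases b1 : (1 : ℝ) ∈ B <;>
    simp_all [questionFun, padd_zero, zero_padd, padd_compl]

theorem questionFun_mono (a : E) {A B : Set ℝ} (h : A ⊆ B) : questionFun a A ≤ questionFun a B :=
  ⟨questionFun a (B \ A), by rw [questionFun_union a disjoint_sdiff_right, union_sdiff_cancel h]⟩

theorem questionFun_congr (a : E) {A B : Set ℝ} (h0 : (0 : ℝ) ∈ A ↔ (0 : ℝ) ∈ B)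
    (h1 : (1 : ℝ) ∈ A ↔ (1 : ℝ) ∈ B) : questionFun a A = questionFun a B := by
  unfold questionFun
  split_ifs <;> first | rfl | tauto

/-- The question observable `q_a`. -/
noncomputable def question (a : E) : Observable E where
  toFun A := questionFun a A.1
  map_univ := by simp [questionFun]
  map_union A B h := questionFun_union a h
  map_iUnion A hA := by
    have hmono : Monotone fun i => (A i).1 := monotone_nat_of_le_succ hA
    have key : ∀ r : ℝ, ∃ n, r ∈ (⋃ i, (A i).1) → r ∈ (A n).1 := fun r => by
      by_cases hr : r ∈ ⋃ i, (A i).1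
      · obtain ⟨n, hn⟩ := mem_iUnion.1 hr
        exact ⟨n, fun _ => hn⟩
      · exact ⟨0, fun h => absurd h hr⟩
    obtain ⟨m, hm⟩ := key 0
    obtain ⟨n, hn⟩ := key 1
    have hsub : (A (max m n)).1 ⊆ ⋃ i, (A i).1 := subset_iUnion (fun i => (A i).1) _
    have e0 : (0 : ℝ) ∈ (⋃ i, (A i).1) ↔ (0 : ℝ) ∈ (A (max m n)).1 :=
      ⟨fun h => hmono (le_max_left m n) (hm h), fun h => hsub h⟩
    have e1 : (1 : ℝ) ∈ (⋃ i, (A i).1) ↔ (1 : ℝ) ∈ (A (max m n)).1 :=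
      ⟨fun h => hmono (le_max_right m n) (hn h), fun h => hsub h⟩
    have heq : questionFun a (⋃ i, (A i).1) = questionFun a (A (max m n)).1 :=
      questionFun_congr a e0 e1
    refine ⟨?_, fun b hb => ?_⟩
    · rintro _ ⟨i, rfl⟩
      exact questionFun_mono a (subset_iUnion (fun i => (A i).1) i)
    · have := hb ⟨max m n, rfl⟩
      rwa [heq]

end Observable

open Observable

/-- The set `O_b(E)` of bounded observables. -/
def boundedObservables (E : Type*) [EffectAlgebra E] : Set (Observable E) :=
  {x | x.IsBounded}

/-- The set `EO(E)` of observables whose spectrum lies in `[0, 1]`. -/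
def effectObservables (E : Type*) [EffectAlgebra E] : Set (Observable E) :=
  {x | x.spectrum ⊆ Icc 0 1}

/-- The preorder of `P` is antisymmetric, and any two elements have a supremum and an infimum. -/
def IsLatticeOrder (P : Type*) [Preorder P] : Prop :=
  (∀ x y : P, x ≤ y → y ≤ x → x = y) ∧
  ∀ x y : P, (∃ s, IsLUB {x, y} s) ∧ ∃ i, IsGLB {x, y} i

/-- `P` is a Dedekind `σ`-complete lattice: a lattice in which every non-empty countable set that is
bounded below has an infimum and every one that is bounded above has a supremum. -/
def IsDedekindSigmaCompleteLattice (P : Type*) [Preorder P] : Prop :=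
  IsLatticeOrder P ∧
  (∀ S : Set P, S.Nonempty → S.Countable → BddBelow S → ∃ i, IsGLB S i) ∧
  (∀ S : Set P, S.Nonempty → S.Countable → BddAbove S → ∃ s, IsLUB S s)

/-- `P` is a `σ`-complete lattice: a lattice in which all countable sets have suprema and infima. -/
def IsSigmaCompleteLattice (P : Type*) [Preorder P] : Prop :=
  IsLatticeOrder P ∧ ∀ S : Set P, S.Countable → (∃ s, IsLUB S s) ∧ ∃ i, IsGLB S i

/-- `P` is a complete lattice: a lattice in which all sets have suprema and infima. -/
def IsCompleteLatticeOrder (P : Type*) [Preorder P] : Prop :=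
  IsLatticeOrder P ∧ ∀ S : Set P, (∃ s, IsLUB S s) ∧ ∃ i, IsGLB S i

/-! The Olson order compares the resolutions t ↦ x((-∞, t)) pointwise and in reverse, and a π-λ
argument shows that the resolution determines the observable (`resolution_injective`). So everything
depends on knowing which functions are resolutions. The key result is
`EffectAlgebra.IsSigmaLattice.exists_observable`: each F with F(t) = ⋁_{u<t} F(u) that is 0 far to
the left and 1 far to the right is a resolution. The pointwise supremum of resolutions is again
left-continuous and gives the infimum of observables. The pointwise infimum need not be, and its
left-continuous regularization gives the supremum. The two formulas then characterize these bounds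
because bounds are unique.

To extend F to the Borel sets, note that its range is a chain, hence a set of pairwise compatible
elements, and lies in a maximal such set. Such a block is closed under complements, existing suprema
and the truncated sum, so it is a σ-complete MV-algebra (`IsBlock.mvAlgebra`).

In that MV-algebra, each [0,1]-valued homomorphism s turns F into a distribution function, hence
into a probability measure μ_s. Such an s need not preserve countable suprema, but
`exists_state_tendsto` yields, for each c ≠ 0, some s with s(c) > 0 that respects countably many
prescribed null sequences. An element e is assigned to a Borel set A when μ_s(A) = s(e) for all s
respecting some countable family of null sequences. Having enough such s makes e unique and monotone
in A; a π-λ argument makes it exist.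

The homomorphisms come from quotients by prime ideals, which are MV-chains. A chain is the unit
interval of an ordered group, and the state measures how many units fit into 2^n copies of an
element, divided by 2^n. -/

open Filter Topology MeasureTheory

/-! ### Arithmetic and order in effect algebras. -/

namespace EffectAlgebra

variable {E : Type*} [EffectAlgebra E] {a b c d e f x y z : E}

theorem padd_assoc_right (h : padd b c = some f) (h2 : padd a f = some e) :
    ∃ d, padd a b = some d ∧ padd d c = some e := by
  rw [padd_comm] at h h2
  obtain ⟨g, hg, hg2⟩ := padd_assoc_left h h2
  exact ⟨g, by rw [padd_comm, hg], by rw [padd_comm, hg2]⟩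

theorem le_of_padd_eq (h : padd a b = some c) : a ≤ c := ⟨b, h⟩

theorem le_of_padd_eq_right (h : padd a b = some c) : b ≤ c := ⟨a, by rw [padd_comm, h]⟩

theorem zero_le (a : E) : 0 ≤ a := ⟨a, zero_padd a⟩

theorem le_one (a : E) : a ≤ 1 := ⟨_, padd_compl a⟩

theorem eq_zero_of_le (h : a ≤ 0) : a = 0 := le_antisymm h (zero_le a)

theorem compl_eq_of_padd (h : padd a b = some 1) : compl a = b :=
  compl_unique (padd_compl a) h

theorem compl_compl (a : E) : compl (compl a) = a :=
  compl_eq_of_padd (by rw [padd_comm, padd_compl])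

theorem compl_zero : compl (0 : E) = 1 := compl_eq_of_padd (zero_padd 1)

theorem compl_one : compl (1 : E) = 0 := compl_eq_of_padd (padd_zero 1)

theorem le_compl_iff : a ≤ compl b ↔ ∃ c, padd a b = some c := by
  constructor
  · rintro ⟨d, hd⟩
    have h : padd d a = some (compl b) := by rw [padd_comm, hd]
    have h2 : padd (compl b) b = some 1 := by rw [padd_comm, padd_compl]
    obtain ⟨g, hg, -⟩ := padd_assoc_left h h2
    exact ⟨g, hg⟩
  · rintro ⟨c, hc⟩
    have h : padd b a = some c := by rw [padd_comm, hc]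
    obtain ⟨g, hg, hg2⟩ := padd_assoc_left h (padd_compl c)
    rw [compl_eq_of_padd hg2]
    exact ⟨_, hg⟩

theorem compl_le_compl (h : a ≤ b) : compl b ≤ compl a := by
  rw [le_compl_iff]
  obtain ⟨d, hd⟩ := h
  have h2 : padd d a = some b := by rw [padd_comm, hd]
  obtain ⟨g, hg, -⟩ := padd_assoc_left h2 (padd_compl b)
  exact ⟨g, by rw [padd_comm, hg]⟩

theorem le_compl_comm : a ≤ compl b ↔ b ≤ compl a := by
  constructor <;> intro h <;> simpa [compl_compl] using compl_le_compl h

theorem compl_le_iff : compl a ≤ b ↔ compl b ≤ a := by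
  constructor <;> intro h <;> simpa [compl_compl] using compl_le_compl h

theorem padd_le_padd (h : padd a c = some e) (h2 : padd b d = some f) (hab : a ≤ b) (hcd : c ≤ d) :
    e ≤ f := by
  obtain ⟨g, hg⟩ := hcd
  obtain ⟨k, hk, hk2⟩ := padd_assoc_right hg h2
  refine le_trans ?_ ⟨g, hk2⟩
  obtain ⟨l, hl⟩ := hab
  have hl' : padd l a = some b := by rw [padd_comm, hl]
  obtain ⟨m, hm, hm2⟩ := padd_assoc_left hl' hk
  rw [h, Option.some.injEq] at hm
  subst hm
  exact le_of_padd_eq_right hm2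

theorem le_of_padd_le_padd (h : padd c a = some e) (h2 : padd c b = some f) (hef : e ≤ f) :
    a ≤ b := by
  obtain ⟨g, hg⟩ := hef
  obtain ⟨k, hk, hk2⟩ := padd_assoc_left h hg
  rw [padd_cancel h2 hk2]
  exact ⟨_, hk⟩

theorem eq_of_padd_self (h : padd a b = some a) : b = 0 := padd_cancel h (padd_zero a)

/-- Two defined sums of two terms each, whose own sum is defined, may be added crosswise. -/
theorem padd_padd_padd_comm (h : padd a b = some e) (h2 : padd c d = some f)
    (h3 : padd e f = some x) :
    ∃ y z, padd a c = some y ∧ padd b d = some z ∧ padd y z = some x := by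
  obtain ⟨g, hg, hg2⟩ := padd_assoc_left h h3
  obtain ⟨k, hk, hk2⟩ := padd_assoc_right h2 hg
  rw [padd_comm] at hk
  obtain ⟨l, hl, hl2⟩ := padd_assoc_left hk hk2
  obtain ⟨m, hm, hm2⟩ := padd_assoc_right hl2 hg2
  exact ⟨m, l, hm, hl, hm2⟩

theorem isLUB_compl {s : Set E} (h : IsGLB s a) : IsLUB (compl '' s) (compl a) := by
  constructor
  · rintro _ ⟨x, hx, rfl⟩
    exact compl_le_compl (h.1 hx)
  · intro u hu
    rw [compl_le_iff]
    exact h.2 fun x hx => compl_le_iff.1 (hu ⟨x, hx, rfl⟩)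

theorem range_ite_eq_pair {α : Type*} (a b : α) : range (fun n : ℕ => if n = 0 then a else b) = {a, b} := by
  ext x
  constructor
  · rintro ⟨n, rfl⟩
    by_cases h : n = 0 <;> simp [h]
  · rintro (rfl | rfl)
    · exact ⟨0, by simp⟩
    · exact ⟨1, by simp⟩

theorem IsSigmaLattice.exists_isLUB_pair (h : IsSigmaLattice E) (a b : E) : ∃ s, IsLUB {a, b} s := by
  rw [← range_ite_eq_pair]; exact (h _).1

theorem IsSigmaLattice.exists_isGLB_pair (h : IsSigmaLattice E) (a b : E) : ∃ s, IsGLB {a, b} s := by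
  rw [← range_ite_eq_pair]; exact (h _).2

/-- The lattice operations of a `σ`-lattice effect algebra. -/
noncomputable instance latticeOfFact [h : Fact (IsSigmaLattice E)] : Lattice E where
  sup a b := (h.out.exists_isLUB_pair a b).choose
  inf a b := (h.out.exists_isGLB_pair a b).choose
  le_sup_left a b := (h.out.exists_isLUB_pair a b).choose_spec.1 (by simp)
  le_sup_right a b := (h.out.exists_isLUB_pair a b).choose_spec.1 (by simp)
  sup_le a b c ha hb := (h.out.exists_isLUB_pair a b).choose_spec.2 (by
    rintro x (rfl | rfl) <;> assumption)
  inf_le_left a b := (h.out.exists_isGLB_pair a b).choose_spec.1 (by simp)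
  inf_le_right a b := (h.out.exists_isGLB_pair a b).choose_spec.1 (by simp)
  le_inf a b c ha hb := (h.out.exists_isGLB_pair b c).choose_spec.2 (by
    rintro x (rfl | rfl) <;> assumption)

/-! ### Differences, truncated sums and compatibility. -/

section SigmaLattice

variable [Fact (IsSigmaLattice E)]

/-- The difference of `a` and `a ⊓ b`. -/
noncomputable def osub (a b : E) : E := (inf_le_left : a ⊓ b ≤ a).choose

theorem padd_osub (a b : E) : padd (a ⊓ b) (osub a b) = some a :=
  (inf_le_left : a ⊓ b ≤ a).choose_spec

theorem osub_eq_zero_iff : osub a b = 0 ↔ a ≤ b := by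
  have h := padd_osub a b
  constructor
  · intro h0
    rw [h0, padd_zero, Option.some.injEq] at h
    exact h ▸ inf_le_right
  · intro hab
    rw [inf_eq_left.2 hab] at h
    exact eq_of_padd_self h

theorem padd_osub_of_le (h : b ≤ a) : padd b (osub a b) = some a := by
  have := padd_osub a b
  rwa [inf_eq_right.2 h] at this

/-- The truncated sum. -/
noncomputable def oadd (a b : E) : E := compl (osub (compl a) b)

theorem padd_oadd (a b : E) : padd a (compl a ⊓ b) = some (oadd a b) := by
  have h : padd (osub (compl a) b) (compl a ⊓ b) = some (compl a) := by
    rw [padd_comm, padd_osub]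
  have h2 : padd (compl a) a = some 1 := by rw [padd_comm, padd_compl]
  obtain ⟨g, hg, hg2⟩ := padd_assoc_left h h2
  rw [oadd, compl_eq_of_padd hg2, padd_comm, hg]

theorem oadd_eq_of_padd (h : padd a b = some c) : oadd a b = c := by
  have h2 : b ≤ compl a := le_compl_comm.1 (le_compl_iff.2 ⟨c, h⟩)
  have := padd_oadd a b
  rw [inf_eq_right.2 h2, h] at this
  exact (Option.some.inj this).symm

/-- Compatibility of two elements. -/
def Compat (a b : E) : Prop := osub a b ≤ compl b

/-- Enlarging `d` to `a ⊓ b` only shrinks the remainder, so any splitting of `a` into a part below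
`b` and a part below `compl b` witnesses compatibility. -/
theorem compat_of_padd (h : padd d x = some a) (hdb : d ≤ b) (hx : x ≤ compl b) : Compat a b := by
  refine le_trans ?_ hx
  obtain ⟨g, hg⟩ := le_inf (le_of_padd_eq h) hdb
  obtain ⟨k, hk, hk2⟩ := padd_assoc_left hg (padd_osub a b)
  rw [padd_cancel h hk2]
  exact le_of_padd_eq_right hk

theorem compat_of_le (h : a ≤ b) : Compat a b := by
  rw [Compat, osub_eq_zero_iff.2 h]
  exact zero_le _

theorem compat_of_ge (h : b ≤ a) : Compat a b := by
  refine compat_of_padd (padd_osub_of_le h) le_rfl ?_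
  exact le_compl_iff.2 ⟨a, by rw [padd_comm, padd_osub_of_le h]⟩

theorem Compat.exists_padd (h : Compat a b) : ∃ w, padd (osub a b) b = some w :=
  le_compl_iff.1 h

theorem Compat.symm (h : Compat a b) : Compat b a := by
  obtain ⟨w, hw⟩ := h.exists_padd
  have hb : padd (a ⊓ b) (osub b a) = some b := by rw [inf_comm, padd_osub]
  obtain ⟨g, hg, hg2⟩ := padd_assoc_right hb hw
  rw [padd_comm, padd_osub, Option.some.injEq] at hg
  subst hg
  exact le_compl_comm.1 (le_compl_iff.2 ⟨w, hg2⟩)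

theorem Compat.padd_osub_eq_sup (h : Compat a b) : padd b (osub a b) = some (a ⊔ b) := by
  obtain ⟨w, hw⟩ := h.exists_padd
  have hb : padd (a ⊓ b) (osub b a) = some b := by rw [inf_comm, padd_osub]
  have haw : a ≤ w := padd_le_padd (by rw [padd_comm, padd_osub]) hw le_rfl inf_le_right
  -- The sum `w` is an upper bound, and `q` is its excess over `a ⊔ b`. By cancellation `q` is a
  -- summand of both differences, so `(a ⊓ b) + q` lies below `a` and below `b`, hence below `a ⊓
  -- b`, and `q = 0`.
  obtain ⟨q, hq⟩ := sup_le haw (le_of_padd_eq_right hw)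
  have key : q = 0 := by
    obtain ⟨p, hp⟩ := (le_sup_right : b ≤ a ⊔ b)
    obtain ⟨r, hr⟩ := (le_sup_left : a ≤ a ⊔ b)
    obtain ⟨k, hk, hk2⟩ := padd_assoc_left hp hq
    obtain ⟨l, hl, hl2⟩ := padd_assoc_left hr hq
    have e1 : osub a b = k := padd_cancel (by rw [padd_comm, hw]) hk2
    obtain ⟨g, hg, hg2⟩ := padd_assoc_right hb hw
    rw [padd_comm, padd_osub, Option.some.injEq] at hg
    subst hg
    have e2 : osub b a = l := padd_cancel hg2 hl2
    subst e1 e2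
    rw [padd_comm] at hk hl
    obtain ⟨m, hm, hm2⟩ := padd_assoc_right hk (padd_osub a b)
    obtain ⟨n, hn, hn2⟩ := padd_assoc_right hl hb
    rw [hm, Option.some.injEq] at hn
    subst hn
    have : m ≤ a ⊓ b := le_inf (le_of_padd_eq hm2) (le_of_padd_eq hn2)
    have : m = a ⊓ b := le_antisymm this (le_of_padd_eq hm)
    subst this
    exact eq_of_padd_self hm
  rw [key, padd_zero, Option.some.injEq] at hq
  rw [padd_comm, hw, hq]

/-- The complement of `a` splits as `osub z a` plus the complement of `z ⊔ a`; the first part is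
below `z`, the second below `compl z`. -/
theorem Compat.compl_left (h : Compat a z) : Compat (compl a) z := by
  have hz : padd (osub z a) (z ⊓ a) = some z := by rw [padd_comm, padd_osub]
  have h1 := h.symm.padd_osub_eq_sup
  obtain ⟨g, hg, hg2⟩ := padd_assoc_left h1 (padd_compl (z ⊔ a))
  have h2 := h.padd_osub_eq_sup
  rw [sup_comm] at h2
  rw [compl_eq_of_padd hg2]
  refine compat_of_padd hg (le_of_padd_eq hz) ?_
  rw [le_compl_comm, le_compl_iff]
  have h3 := padd_compl (z ⊔ a)
  rw [padd_comm] at h2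
  obtain ⟨k, hk, -⟩ := padd_assoc_left h2 h3
  exact ⟨k, hk⟩

/-- Every `a ∈ s` is below `(x ⊓ z) + compl z`, so `x` is too; cancelling `x ⊓ z` bounds `osub x z`
by `compl z`. No distributive law is needed. -/
theorem Compat.isLUB {s : Set E} (h : ∀ a ∈ s, Compat a z) (hs : IsLUB s x) : Compat x z := by
  have hle : x ⊓ z ≤ compl (compl z) := by rw [compl_compl]; exact inf_le_right
  obtain ⟨w, hw⟩ := le_compl_iff.1 hle
  have hxw : x ≤ w := hs.2 fun a ha =>
    padd_le_padd (padd_osub a z) hw (inf_le_inf_right z (hs.1 ha)) (h a ha)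
  exact le_of_padd_le_padd (padd_osub x z) hw hxw

/-- Both the meet with `z` and the remainder grow from `x` to `y`, by `d` and `r` say. Adding
crosswise gives `a = d + r` with `d` below `z` and `r` below `compl z`. -/
theorem Compat.of_padd (hx : Compat x z) (hy : Compat y z) (h : padd x a = some y) :
    Compat a z := by
  have hxy : x ≤ y := ⟨a, h⟩
  obtain ⟨d, hd⟩ := inf_le_inf_right z hxy
  obtain ⟨r, hr⟩ := le_of_padd_le_padd hx.padd_osub_eq_sup hy.padd_osub_eq_sup
    (sup_le_sup_right hxy z)
  obtain ⟨p, q, hp, hq, hpq⟩ := padd_padd_padd_comm hd hr (padd_osub y z)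
  rw [padd_osub, Option.some.injEq] at hp
  subst hp
  rw [padd_cancel h hpq]
  exact compat_of_padd hq ((le_of_padd_eq_right hd).trans inf_le_right)
    ((le_of_padd_eq_right hr).trans hy)

/-! ### Blocks and their closure properties. -/

/-- A block: a maximal set of pairwise compatible elements. -/
def IsBlock (B : Set E) : Prop := ∀ a, a ∈ B ↔ ∀ b ∈ B, Compat a b

theorem exists_isBlock {s : Set E} (hs : ∀ a ∈ s, ∀ b ∈ s, Compat a b) :
    ∃ B, s ⊆ B ∧ IsBlock B := by
  obtain ⟨B, hsB, hB⟩ := zorn_subset_nonempty {t : Set E | ∀ a ∈ t, ∀ b ∈ t, Compat a b} (by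
    intro c hc hchain hne
    refine ⟨⋃₀ c, ?_, fun t ht => subset_sUnion_of_mem ht⟩
    rintro a ⟨t, ht, hat⟩ b ⟨u, hu, hbu⟩
    rcases hchain.total ht hu with h | h
    · exact hc hu a (h hat) b hbu
    · exact hc ht a hat b (h hbu)) s hs
  refine ⟨B, hsB, fun a => ⟨fun ha b hb => hB.prop a ha b hb, fun ha => ?_⟩⟩
  have : insert a B ∈ {t : Set E | ∀ a ∈ t, ∀ b ∈ t, Compat a b} := by
    rintro x (rfl | hx) y (rfl | hy)
    · exact compat_of_le le_rfl
    · exact ha y hy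
    · exact (ha x hx).symm
    · exact hB.prop x hx y hy
  exact hB.le_of_ge this (subset_insert a B) (mem_insert a B)

namespace IsBlock

variable {B : Set E} (hB : IsBlock B)
include hB

theorem compat (ha : a ∈ B) (hb : b ∈ B) : Compat a b := (hB a).1 ha b hb

theorem compl_mem (ha : a ∈ B) : compl a ∈ B :=
  (hB _).2 fun _ hb => (hB.compat ha hb).compl_left

theorem zero_mem : (0 : E) ∈ B := (hB _).2 fun b _ => compat_of_le (zero_le b)

theorem isLUB_mem {s : Set E} (hs : s ⊆ B) (h : IsLUB s x) : x ∈ B :=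
  (hB _).2 fun _ hb => Compat.isLUB (fun _ ha => hB.compat (hs ha) hb) h

theorem isGLB_mem {s : Set E} (hs : s ⊆ B) (h : IsGLB s x) : x ∈ B := by
  rw [← compl_compl x]
  refine hB.compl_mem (hB.isLUB_mem ?_ (isLUB_compl h))
  rintro _ ⟨a, ha, rfl⟩
  exact hB.compl_mem (hs ha)

theorem inf_mem (ha : a ∈ B) (hb : b ∈ B) : a ⊓ b ∈ B :=
  hB.isGLB_mem (s := {a, b}) (by rintro x (rfl | rfl) <;> assumption) isGLB_pair

theorem of_padd_mem (ha : a ∈ B) (hc : c ∈ B) (h : padd a b = some c) : b ∈ B :=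
  (hB _).2 fun _ hz => (hB.compat ha hz).of_padd (hB.compat hc hz) h

theorem osub_mem (ha : a ∈ B) (hb : b ∈ B) : osub a b ∈ B :=
  hB.of_padd_mem (hB.inf_mem ha hb) ha (padd_osub a b)

theorem oadd_mem (ha : a ∈ B) (hb : b ∈ B) : oadd a b ∈ B :=
  hB.compl_mem (hB.osub_mem (hB.compl_mem ha) hb)

end IsBlock

theorem sup_compl (a b : E) : compl (a ⊔ b) = compl a ⊓ compl b := by
  refine le_antisymm (le_inf (compl_le_compl le_sup_left) (compl_le_compl le_sup_right)) ?_
  rw [le_compl_comm]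
  exact sup_le (le_compl_comm.1 inf_le_left) (le_compl_comm.1 inf_le_right)

/-- Complementing `b + osub (compl a) b = compl a ⊔ b` shows that `osub (compl a) b` and `osub
(compl b) a` both complete `a ⊓ compl b` to `compl b`. -/
theorem oadd_comm (h : Compat (compl a) b) : oadd a b = oadd b a := by
  have h1 := h.padd_osub_eq_sup
  obtain ⟨g, hg, hg2⟩ := padd_assoc_left h1 (padd_compl _)
  rw [sup_compl, compl_compl] at hg
  rw [← compl_eq_of_padd hg2, inf_comm] at hg
  have h2 : osub (compl a) b = osub (compl b) a :=
    padd_cancel (by rw [padd_comm, hg]) (padd_osub (compl b) a)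
  rw [oadd, h2, oadd]

theorem padd_sup (h : padd a d = some x) (h2 : padd a e = some y) :
    padd a (d ⊔ e) = some (x ⊔ y) := by
  have hd : d ⊔ e ≤ compl a := sup_le (le_compl_comm.1 (le_compl_iff.2 ⟨x, h⟩))
    (le_compl_comm.1 (le_compl_iff.2 ⟨y, h2⟩))
  obtain ⟨w, hw⟩ := le_compl_iff.1 (le_compl_comm.1 hd)
  obtain ⟨v, hv⟩ : a ≤ x ⊔ y := (le_of_padd_eq h).trans le_sup_left
  have h1 : x ⊔ y ≤ w := sup_le (padd_le_padd h hw le_rfl le_sup_left)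
    (padd_le_padd h2 hw le_rfl le_sup_right)
  have h3 : d ⊔ e ≤ v := sup_le (le_of_padd_le_padd h hv le_sup_left)
    (le_of_padd_le_padd h2 hv le_sup_right)
  rw [hw, le_antisymm (padd_le_padd hw hv le_rfl h3) h1]

theorem compl_oadd_compl (a b : E) : compl (oadd (compl a) b) = osub a b := by
  rw [oadd, compl_compl, compl_compl]

/-- This becomes associativity of the truncated sum after complementation. Computing `x ⊔ oadd a b`
from `a` upwards and from `oadd a b` upwards, then cancelling, gives the claim with `compl a ⊓ b` in
place of `b`; the two agree because `osub x a ≤ compl a`. -/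
theorem IsBlock.osub_oadd {B : Set E} (hB : IsBlock B) (hx : x ∈ B) (ha : a ∈ B) (hb : b ∈ B) :
    osub x (oadd a b) = osub (osub x a) b := by
  have hp := padd_oadd a b
  have hd := (hB.compat hx ha).padd_osub_eq_sup
  have hda : osub x a ≤ compl a := hB.compat hx ha
  have hpB : compl a ⊓ b ∈ B := hB.inf_mem (hB.compl_mem ha) hb
  have h1 := (hB.compat (hB.osub_mem hx ha) hpB).padd_osub_eq_sup
  have h2 := (hB.compat hx (hB.oadd_mem ha hb)).padd_osub_eq_sup
  have h3 := padd_sup hd hp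
  have hs : (x ⊔ a) ⊔ oadd a b = x ⊔ oadd a b := by
    rw [sup_assoc, sup_eq_right.2 (le_of_padd_eq hp)]
  rw [hs] at h3
  obtain ⟨g, hg, hg2⟩ := padd_assoc_left hp h2
  rw [← padd_cancel h3 hg2] at hg
  rw [padd_cancel hg h1]
  have hi : osub x a ⊓ (compl a ⊓ b) = osub x a ⊓ b := by
    rw [← inf_assoc, inf_eq_left.2 hda]
  have h4 := padd_osub (osub x a) (compl a ⊓ b)
  rw [hi] at h4
  exact padd_cancel h4 (padd_osub (osub x a) b)

theorem Compat.oadd_osub (h : Compat a b) : oadd (osub a b) b = a ⊔ b :=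
  oadd_eq_of_padd (by rw [padd_comm, h.padd_osub_eq_sup])

end SigmaLattice

end EffectAlgebra

/-! ### Identities in MV-algebras. -/

/-- MV-algebras: `+` is the truncated sum, `neg` the negation, and `neg 0` the unit. -/
class MVBase (M : Type*) extends AddCommMonoid M where
  neg : M → M
  mvNeg_neg : ∀ a, neg (neg a) = a
  add_neg_zero : ∀ a, a + neg 0 = neg 0
  luk : ∀ a b, neg (neg a + b) + b = neg (neg b + a) + a

namespace MVBase

attribute [simp] mvNeg_neg add_neg_zero

variable {M : Type*} [MVBase M] {a b c : M}

@[simp] theorem neg_zero_add (a : M) : neg 0 + a = neg 0 := by rw [add_comm, add_neg_zero]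

theorem mvNeg_injective : Function.Injective (neg : M → M) := fun a b h => by
  rw [← mvNeg_neg a, h, mvNeg_neg]

theorem add_neg_self (a : M) : a + neg a = neg 0 := by
  have := luk a (neg 0)
  simpa [add_comm] using this.symm

theorem neg_add_self (a : M) : neg a + a = neg 0 := by rw [add_comm, add_neg_self]

/-- The product dual to the truncated sum. -/
def mvMul (a b : M) : M := neg (neg a + neg b)

theorem mvMul_comm (a b : M) : mvMul a b = mvMul b a := by rw [mvMul, add_comm, mvMul]

theorem mvMul_assoc (a b c : M) : mvMul (mvMul a b) c = mvMul a (mvMul b c) := by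
  simp [mvMul, add_assoc]

theorem mul_eq_zero_iff : mvMul a b = 0 ↔ neg a + neg b = neg 0 := by
  rw [mvMul, ← mvNeg_injective.eq_iff, mvNeg_neg]

theorem mvMul_one (a : M) : mvMul a (neg 0) = a := by simp [mvMul]

theorem mvNeg_mul (a b : M) : neg (mvMul a b) = neg a + neg b := by simp [mvMul]

theorem mul_neg_neg (a b : M) : mvMul (neg a) (neg b) = neg (a + b) := by simp [mvMul]

theorem neg_add_mul (h : b + c = neg 0) : neg b + mvMul b c = c := by
  have := luk c (neg b)
  rw [mvNeg_neg, h, mvNeg_neg, zero_add, add_comm (neg c)] at this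
  rw [mvMul, add_comm, this]

/-- A sum with a product as one term, when two partial sums reach the unit. -/
theorem mul_add_eq_add_mul (h : a + b = neg 0) (h2 : b + c = neg 0) :
    mvMul a b + c = a + mvMul b c := by
  have e1 : neg b + mvMul a b = a := by
    rw [mvMul_comm]; exact neg_add_mul (by rw [add_comm, h])
  have e2 := neg_add_mul h2
  calc mvMul a b + c = mvMul a b + (neg b + mvMul b c) := by rw [e2]
    _ = (neg b + mvMul a b) + mvMul b c := by abel
    _ = a + mvMul b c := by rw [e1]

theorem mul_add_mul (h : mvMul a b = 0) (h2 : mvMul b c = 0) : mvMul (a + b) c = mvMul a (b + c) := by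
  rw [mul_eq_zero_iff] at h h2
  have := mul_add_eq_add_mul h h2
  apply mvNeg_injective
  rw [mvNeg_mul, mvNeg_mul, ← mul_neg_neg, ← mul_neg_neg, this]

theorem neg_add_cancel (h : mvMul a b = 0) : neg (neg (a + b) + a) = b := by
  rw [mul_eq_zero_iff] at h
  have := luk (neg b) a
  rw [mvNeg_neg, h, mvNeg_neg, zero_add, add_comm b a] at this
  rw [this, mvNeg_neg]

/-- The elements `neg (b + c)` and `mvMul a b + c` are orthogonal with sum `a`, so cancelling the
first from `a` leaves the second. -/
theorem mul_add_of_mul_eq_zero (h : a + b = neg 0) (h2 : mvMul b c = 0) :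
    mvMul a (b + c) = mvMul a b + c := by
  have e1 : neg b + mvMul a b = a := by
    rw [mvMul_comm]; exact neg_add_mul (by rw [add_comm, h])
  have e2 : neg (b + c) + c = neg b := by
    have := luk (neg b) c
    rw [mvNeg_neg] at this
    rw [this]
    rw [mul_eq_zero_iff] at h2
    rw [add_comm (neg c), h2, mvNeg_neg, zero_add]
  have e3 : neg (b + c) + (mvMul a b + c) = a := by
    calc neg (b + c) + (mvMul a b + c) = (neg (b + c) + c) + mvMul a b := by abel
      _ = a := by rw [e2, e1]
  have e4 : mvMul (neg (b + c)) (mvMul a b + c) = 0 := by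
    rw [mul_eq_zero_iff, mvNeg_neg]
    have := luk (neg (mvMul a b)) c
    rw [mvNeg_neg] at this
    calc b + c + neg (mvMul a b + c) = b + (neg (mvMul a b + c) + c) := by abel
      _ = b + (neg a + neg b) + neg (neg c + neg (mvMul a b)) := by rw [this, mvNeg_mul]; abel
      _ = (b + neg b) + neg a + neg (neg c + neg (mvMul a b)) := by abel
      _ = neg 0 := by rw [add_neg_self, neg_zero_add, neg_zero_add]
  have := neg_add_cancel e4
  rw [e3] at this
  rw [mvMul, this]

end MVBase

/-! ### MV-chains: the ordered group cone and its state. -/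

open MVBase

/-- Linearity of an MV-algebra. -/
def IsMVChain (C : Type*) [MVBase C] : Prop := ∀ a b : C, a + b = neg 0 ∨ mvMul a b = 0

/-- The positive cone of the ordered group that has the MV-chain `C` as its unit interval: the pair
`(k, r)` stands for `k` times the unit plus the element `r` below the unit. -/
structure CarryPair (C : Type*) [MVBase C] where
  count : ℕ
  rem : C
  ne : rem ≠ neg 0

namespace CarryPair

variable {C : Type*} [MVBase C]

theorem ext' {p q : CarryPair C} (h : p.count = q.count) (h2 : p.rem = q.rem) : p = q := by
  cases p; cases q; simp_all

theorem mul_ne {a b : C} (ha : a ≠ neg 0) : mvMul a b ≠ neg 0 := fun h => ha (by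
  have h2 : neg a + neg b = 0 := by rw [← mvNeg_mul, h, mvNeg_neg]
  have h3 : neg (mvMul a b) + (a + b) = neg 0 := by
    calc neg (mvMul a b) + (a + b) = (neg a + a) + (neg b + b) := by rw [mvNeg_mul]; abel
      _ = neg 0 := by rw [neg_add_self, neg_zero_add]
  have h4 : a + (neg a + neg b) = neg 0 := by rw [← add_assoc, add_neg_self, neg_zero_add]
  rwa [h2, add_zero] at h4)

open Classical in
/-- The carry of the sum of two elements. -/
noncomputable def carry (a b : C) : ℕ := if a + b = neg 0 then 1 else 0

open Classical in
/-- The remainder of the sum of two elements. -/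
noncomputable def remainder (a b : C) : C := if a + b = neg 0 then mvMul a b else a + b

theorem carry_of_eq {a b : C} (h : a + b = neg 0) : carry a b = 1 := if_pos h

theorem carry_of_ne {a b : C} (h : a + b ≠ neg 0) : carry a b = 0 := if_neg h

theorem remainder_of_eq {a b : C} (h : a + b = neg 0) : remainder a b = mvMul a b := if_pos h

theorem remainder_of_ne {a b : C} (h : a + b ≠ neg 0) : remainder a b = a + b := if_neg h

theorem remainder_ne {a b : C} (ha : a ≠ neg 0) : remainder a b ≠ neg 0 := by
  unfold remainder
  split_ifs with h
  · exact mul_ne ha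
  · exact h

theorem remainder_comm (a b : C) : remainder a b = remainder b a := by
  by_cases h : a + b = neg 0
  · rw [remainder_of_eq h, remainder_of_eq (by rw [add_comm, h]), mvMul_comm]
  · rw [remainder_of_ne h, remainder_of_ne (by rwa [add_comm]), add_comm]

theorem carry_comm (a b : C) : carry a b = carry b a := by
  by_cases h : a + b = neg 0
  · rw [carry_of_eq h, carry_of_eq (by rw [add_comm, h])]
  · rw [carry_of_ne h, carry_of_ne (by rwa [add_comm])]

theorem carry_le_one (a b : C) : carry a b ≤ 1 := by
  unfold carry; split_ifs <;> simp

/-- Split by whether `a + b` and `b + c` reach the unit. In a chain a sum short of the unit has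
product `0`, which is what the mixed product-sum identities need; the mixed cases always carry
exactly once in total. -/
theorem carry_remainder_assoc (hC : IsMVChain C) {a b c : C} (ha : a ≠ neg 0) (hc : c ≠ neg 0) :
    carry a b + carry (remainder a b) c = carry b c + carry a (remainder b c) ∧
      remainder (remainder a b) c = remainder a (remainder b c) := by
  by_cases h : a + b = neg 0 <;> by_cases h2 : b + c = neg 0
  · have h3 := mul_add_eq_add_mul h h2
    rw [carry_of_eq h, carry_of_eq h2, remainder_of_eq h, remainder_of_eq h2]
    by_cases h4 : mvMul a b + c = neg 0
    · have h5 := h3 ▸ h4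
      rw [carry_of_eq h4, carry_of_eq h5, remainder_of_eq h4, remainder_of_eq h5, mvMul_assoc]
      exact ⟨rfl, rfl⟩
    · have h5 := h3 ▸ h4
      rw [carry_of_ne h4, carry_of_ne h5, remainder_of_ne h4, remainder_of_ne h5, h3]
      exact ⟨rfl, rfl⟩
  · have h4 := mul_add_of_mul_eq_zero h ((hC b c).resolve_left h2)
    have h5 : a + (b + c) = neg 0 := by rw [← add_assoc, h, neg_zero_add]
    have h6 : mvMul a b + c ≠ neg 0 := h4 ▸ mul_ne ha
    rw [carry_of_eq h, carry_of_ne h2, remainder_of_eq h, remainder_of_ne h2, carry_of_eq h5,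
      carry_of_ne h6, remainder_of_eq h5, remainder_of_ne h6, h4]
    exact ⟨rfl, rfl⟩
  · have h4 := mul_add_of_mul_eq_zero (a := c) (b := b) (c := a) (by rw [add_comm, h2])
      (by rw [mvMul_comm]; exact (hC a b).resolve_left h)
    rw [mvMul_comm c, add_comm b a, mvMul_comm c b, add_comm (mvMul b c)] at h4
    have h5 : (a + b) + c = neg 0 := by rw [add_assoc, h2, add_neg_zero]
    have h6 : a + mvMul b c ≠ neg 0 := fun h7 => by
      rw [h7, mvMul_comm] at h4
      exact mul_ne hc h4
    rw [carry_of_ne h, carry_of_eq h2, remainder_of_ne h, remainder_of_eq h2, carry_of_eq h5,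
      carry_of_ne h6, remainder_of_eq h5, remainder_of_ne h6, h4]
    exact ⟨rfl, rfl⟩
  · have h3 := mul_add_mul ((hC a b).resolve_left h) ((hC b c).resolve_left h2)
    rw [carry_of_ne h, carry_of_ne h2, remainder_of_ne h, remainder_of_ne h2]
    by_cases h4 : a + b + c = neg 0
    · have h5 := add_assoc a b c ▸ h4
      rw [carry_of_eq h4, carry_of_eq h5, remainder_of_eq h4, remainder_of_eq h5, h3]
      exact ⟨rfl, rfl⟩
    · have h5 := add_assoc a b c ▸ h4
      rw [carry_of_ne h4, carry_of_ne h5, remainder_of_ne h4, remainder_of_ne h5, add_assoc]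
      exact ⟨rfl, rfl⟩

noncomputable instance : Add (CarryPair C) where
  add p q := ⟨p.count + q.count + carry p.rem q.rem, remainder p.rem q.rem, remainder_ne p.ne⟩

theorem count_add (p q : CarryPair C) :
    (p + q).count = p.count + q.count + carry p.rem q.rem := rfl

theorem rem_add (p q : CarryPair C) : (p + q).rem = remainder p.rem q.rem := rfl

theorem add_comm' (p q : CarryPair C) : p + q = q + p := by
  apply ext'
  · rw [count_add, count_add, carry_comm, add_comm p.count]
  · rw [rem_add, rem_add, remainder_comm]

theorem add_assoc' (hC : IsMVChain C) (p q r : CarryPair C) : p + q + r = p + (q + r) := by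
  obtain ⟨h, h2⟩ := carry_remainder_assoc hC (b := q.rem) p.ne r.ne
  apply ext'
  · simp only [count_add, rem_add]; omega
  · simp only [rem_add, h2]

/-- The sum of `2 ^ n` copies of `p`. -/
noncomputable def double (p : CarryPair C) : ℕ → CarryPair C
  | 0 => p
  | n + 1 => double p n + double p n

theorem double_add (hC : IsMVChain C) (p q : CarryPair C) (n : ℕ) :
    double (p + q) n = double p n + double q n := by
  induction n with
  | zero => rfl
  | succ n ih =>
    simp only [double, ih, add_assoc' hC]
    rw [← add_assoc' hC (double q n), add_comm' (double q n) (double p n), add_assoc' hC]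

/-- Doubling carries at most `1`, so `count + 1` at most doubles. This keeps the increasing sequence
`approx p` bounded. -/
theorem count_double_lt (p : CarryPair C) (n : ℕ) :
    (double p n).count + 1 ≤ 2 ^ n * (p.count + 1) := by
  induction n with
  | zero => simp [double]
  | succ n ih =>
    have := carry_le_one (double p n).rem (double p n).rem
    rw [double, count_add, pow_succ]; nlinarith

/-- The approximations to the value of `p` under the state. -/
noncomputable def approx (p : CarryPair C) (n : ℕ) : ℝ := (double p n).count / 2 ^ n

theorem approx_mono (p : CarryPair C) : Monotone (approx p) := by
  refine monotone_nat_of_le_succ fun n => ?_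
  rw [approx, approx, div_le_div_iff₀ (by positivity) (by positivity), double, count_add, pow_succ]
  push_cast
  have : (0 : ℝ) ≤ carry (double p n).rem (double p n).rem := by positivity
  have h2 : (0 : ℝ) < 2 ^ n := by positivity
  nlinarith

theorem approx_le (p : CarryPair C) (n : ℕ) : approx p n ≤ p.count + 1 := by
  rw [approx, div_le_iff₀ (by positivity)]
  have := count_double_lt p n
  have h : ((double p n).count : ℝ) + 1 ≤ 2 ^ n * (p.count + 1) := by exact_mod_cast this
  linarith

/-- The value of `p` under the state. -/
noncomputable def value (p : CarryPair C) : ℝ := ⨆ n, approx p n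

theorem bddAbove_approx (p : CarryPair C) : BddAbove (range (approx p)) :=
  ⟨p.count + 1, by rintro _ ⟨n, rfl⟩; exact approx_le p n⟩

theorem tendsto_approx (p : CarryPair C) : Tendsto (approx p) atTop (𝓝 (value p)) :=
  tendsto_atTop_ciSup (approx_mono p) (bddAbove_approx p)

theorem count_le_value (p : CarryPair C) : p.count ≤ value p := by
  refine le_trans ?_ (le_ciSup (bddAbove_approx p) 0)
  simp [approx, double]

/-- The approximation of `p + q` exceeds the sum of the two approximations by one carry over `2 ^
n`, at most `1 / 2 ^ n`. -/
theorem value_add (hC : IsMVChain C) (p q : CarryPair C) : value (p + q) = value p + value q := by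
  have h0 : Tendsto (fun n : ℕ => (1 : ℝ) / 2 ^ n) atTop (𝓝 0) := by
    simpa using tendsto_pow_atTop_nhds_zero_of_lt_one (r := (1 / 2 : ℝ)) (by norm_num) (by norm_num)
  have h1 := (tendsto_approx p).add (tendsto_approx q)
  have h2 := h1.add h0
  rw [add_zero] at h2
  refine tendsto_nhds_unique (tendsto_approx (p + q))
    (tendsto_of_tendsto_of_tendsto_of_le_of_le h1 h2 (fun n => ?_) fun n => ?_)
  all_goals
    have hn : (0 : ℝ) < 2 ^ n := by positivity
    have hc : ((carry (double p n).rem (double q n).rem : ℕ) : ℝ) ≤ 1 := by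
      exact_mod_cast carry_le_one _ _
    have hc0 : (0 : ℝ) ≤ ((carry (double p n).rem (double q n).rem : ℕ) : ℝ) := by positivity
    simp only [approx]
    rw [double_add hC, count_add]
    push_cast
    rw [← add_div]
  · exact div_le_div_of_nonneg_right (by linarith) hn.le
  · rw [← add_div]; exact div_le_div_of_nonneg_right (by linarith) hn.le

open Classical in
/-- The embedding of the chain. -/
noncomputable def ofChain (h01 : (0 : C) ≠ neg 0) (a : C) : CarryPair C :=
  if h : a = neg 0 then ⟨1, 0, h01⟩ else ⟨0, a, h⟩

theorem ofChain_add (h01 : (0 : C) ≠ neg 0) {a b : C} (h : mvMul a b = 0) :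
    ofChain h01 (a + b) = ofChain h01 a + ofChain h01 b := by
  have hsum : (0 : C) + 0 ≠ neg 0 := by rwa [add_zero]
  by_cases ha : a = neg 0
  · subst ha
    have hb : b = 0 := by rwa [mvMul_comm, mvMul_one] at h
    subst hb
    rw [add_zero]
    apply ext' <;> simp [ofChain, h01, count_add, rem_add, carry_of_ne hsum, remainder_of_ne hsum]
  by_cases hb : b = neg 0
  · subst hb
    have ha : a = 0 := by rwa [mvMul_one] at h
    subst ha
    rw [zero_add]
    apply ext' <;> simp [ofChain, h01, count_add, rem_add, carry_of_ne hsum, remainder_of_ne hsum]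
  by_cases hab : a + b = neg 0
  · apply ext' <;>
      simp [ofChain, ha, hb, hab, count_add, rem_add, carry_of_eq hab, remainder_of_eq hab, h]
  · apply ext' <;>
      simp [ofChain, ha, hb, hab, count_add, rem_add, carry_of_ne hab, remainder_of_ne hab]

theorem double_one (h01 : (0 : C) ≠ neg 0) (n : ℕ) :
    double (ofChain h01 (neg 0)) n = ⟨2 ^ n, 0, h01⟩ := by
  induction n with
  | zero => simp [double, ofChain]
  | succ n ih =>
    have hsum : (0 : C) + 0 ≠ neg 0 := by rwa [add_zero]
    rw [double, ih]
    apply ext'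
    · simp [count_add, carry_of_ne hsum]; ring
    · simp [rem_add, remainder_of_ne hsum]

end CarryPair

/-- Every nontrivial MV-chain has a state. -/
theorem IsMVChain.exists_state {C : Type*} [MVBase C] (hC : IsMVChain C) (h01 : (0 : C) ≠ neg 0) :
    ∃ s : C → ℝ, (∀ a, 0 ≤ s a) ∧ s (neg 0) = 1 ∧ ∀ a b, mvMul a b = 0 → s (a + b) = s a + s b := by
  refine ⟨fun a => CarryPair.value (CarryPair.ofChain h01 a), fun a => ?_, ?_, fun a b h => ?_⟩
  · exact le_trans (by positivity) (CarryPair.count_le_value _)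
  · have : ∀ n, CarryPair.approx (CarryPair.ofChain h01 (neg 0)) n = 1 := fun n => by
      rw [CarryPair.approx, CarryPair.double_one]
      simp
    simp [CarryPair.value, this]
  · simp only [CarryPair.ofChain_add h01 h, CarryPair.value_add hC]

/-! ### Order, ideals and quotients of MV-algebras. -/

/-- MV-algebras with their natural order. -/
class MVAlgebra (M : Type*) extends MVBase M, PartialOrder M where
  le_iff : ∀ a b : M, a ≤ b ↔ neg a + b = neg 0

namespace MVAlgebra

variable {M : Type*} [MVAlgebra M] {a b c x y z : M}

instance : Sub M := ⟨fun a b => neg (neg a + b)⟩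

theorem sub_def (a b : M) : a - b = neg (neg a + b) := rfl

instance : OrderedSub M where
  tsub_le_iff_right a b c := by
    rw [le_iff, le_iff, sub_def, mvNeg_neg, add_assoc, add_comm b c]

theorem sub_add_comm (a b : M) : a - b + b = b - a + a := luk a b

theorem sub_add_of_le (h : a ≤ b) : b - a + a = b := by
  rw [le_iff] at h
  rw [← sub_add_comm, sub_def, h, mvNeg_neg, zero_add]

instance : CanonicallyOrderedAdd M where
  exists_add_of_le {a b} h := ⟨b - a, by rw [add_comm, sub_add_of_le h]⟩
  le_self_add a b := by rw [le_iff, ← add_assoc, neg_add_self, neg_zero_add]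
  le_add_self a b := by rw [le_iff, add_left_comm, neg_add_self, add_neg_zero]

instance : IsOrderedAddMonoid M where
  add_le_add_left a b h c := by
    obtain ⟨d, rfl⟩ := exists_add_of_le h
    rw [add_right_comm]
    exact le_self_add

theorem le_neg_zero (a : M) : a ≤ neg 0 := by rw [le_iff, add_neg_zero]

theorem sub_eq_zero_iff : a - b = 0 ↔ a ≤ b := by
  rw [le_iff, sub_def, ← mvNeg_injective.eq_iff, mvNeg_neg]

theorem neg_zero_sub (a : M) : neg 0 - a = neg a := by simp [sub_def]

theorem neg_sub_neg (a b : M) : neg a - neg b = b - a := by simp [sub_def, add_comm]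

theorem sub_neg (a b : M) : a - neg b = mvMul a b := rfl

theorem neg_le_neg (h : a ≤ b) : neg b ≤ neg a := by
  rw [← sub_eq_zero_iff, neg_sub_neg, sub_eq_zero_iff.2 h]

theorem neg_le_neg_iff : neg b ≤ neg a ↔ a ≤ b :=
  ⟨fun h => by simpa using neg_le_neg h, neg_le_neg⟩

theorem neg_sub_add (a b : M) : neg (a + b) = neg a - b := by simp [sub_def]

theorem add_sub_cancel_of_le (h : b ≤ neg a) : a + b - a = b := by
  rw [le_iff] at h
  exact neg_add_cancel (by rw [mul_eq_zero_iff, add_comm, h])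

theorem sub_le_neg (a b : M) : a - b ≤ neg b := by
  rw [sub_def]
  exact neg_le_neg le_add_self

theorem sub_sub_of_le (h : b ≤ a) : a - (a - b) = b := by
  have h2 : a - b ≤ neg b := sub_le_neg a b
  have h3 := add_sub_cancel_of_le (a := a - b) (b := b) (by
    rw [← neg_le_neg_iff, mvNeg_neg]; exact h2)
  rwa [sub_add_of_le h] at h3

theorem le_sub_sub (h : z ≤ a) (h2 : z ≤ b) : z ≤ a - (a - b) :=
  calc z = a - (a - z) := (sub_sub_of_le h).symm
    _ ≤ a - (a - b) := tsub_le_tsub_left (tsub_le_tsub_left h2 a) a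

/-- Prelinearity. -/
theorem eq_zero_of_le_sub_of_le_sub (h : z ≤ a - b) (h2 : z ≤ b - a) : z = 0 := by
  -- Here `w` is the meet of `a` and `b`. Then `w + z` is below both, hence below `w`; as `z` is
  -- orthogonal to `w`, cancellation gives `z = 0`.
  set w := a - (a - b) with hw
  have hwa : w + (a - b) = a := sub_add_of_le tsub_le_self
  have hw2 : w = b - (b - a) :=
    le_antisymm (le_sub_sub tsub_tsub_le tsub_le_self) (le_sub_sub tsub_tsub_le tsub_le_self)
  have hwb : w + (b - a) = b := by rw [hw2]; exact sub_add_of_le tsub_le_self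
  have h3 : w + z ≤ w := le_sub_sub ((add_le_add_right h w).trans hwa.le)
    ((add_le_add_right h2 w).trans hwb.le)
  have h4 : z ≤ neg w := h.trans (by
    rw [← neg_le_neg_iff, mvNeg_neg]; exact sub_le_neg a (a - b))
  have h5 := add_sub_cancel_of_le h4
  rw [sub_eq_zero_iff.2 h3] at h5
  exact h5.symm

theorem eq_zero_of_le_nsmul (h : ∀ z, z ≤ x → z ≤ y → z = 0) (n : ℕ) :
    ∀ z, z ≤ n • x → z ≤ y → z = 0 := by
  induction n with
  | zero => intro z hz _; simpa using hz
  | succ n ih =>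
    intro z hz hy
    rw [succ_nsmul, ← tsub_le_iff_right] at hz
    exact h z (sub_eq_zero_iff.1 (ih _ hz (tsub_le_self.trans hy))) hy

/-- Ideals. -/
structure IsMVIdeal (P : Set M) : Prop where
  zero_mem : (0 : M) ∈ P
  add_mem : ∀ {a b}, a ∈ P → b ∈ P → a + b ∈ P
  mem_of_le : ∀ {a b}, a ≤ b → b ∈ P → a ∈ P

namespace IsMVIdeal

variable {P : Set M}

/-- The congruence of an ideal. -/
def con (hP : IsMVIdeal P) : AddCon M where
  r a b := a - b ∈ P ∧ b - a ∈ P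
  iseqv := by
    refine ⟨fun a => ?_, fun h => ⟨h.2, h.1⟩, fun {a b c} h h2 => ⟨?_, ?_⟩⟩
    · rw [sub_eq_zero_iff.2 le_rfl]
      exact ⟨hP.zero_mem, hP.zero_mem⟩
    · exact hP.mem_of_le (tsub_le_tsub_add_tsub (b := b)) (hP.add_mem h.1 h2.1)
    · exact hP.mem_of_le (tsub_le_tsub_add_tsub (b := b)) (hP.add_mem h2.2 h.2)
  add' {a b c d} h h2 := by
    have key : ∀ a b c d : M, (a + c) - (b + d) ≤ (a - b) + (c - d) := fun a b c d => by
      rw [tsub_le_iff_right]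
      calc a + c ≤ (a - b + b) + (c - d + d) := add_le_add le_tsub_add le_tsub_add
        _ = a - b + (c - d) + (b + d) := add_add_add_comm _ _ _ _
    exact ⟨hP.mem_of_le (key _ _ _ _) (hP.add_mem h.1 h2.1),
      hP.mem_of_le (key _ _ _ _) (hP.add_mem h.2 h2.2)⟩

/-- The class of an element. -/
def cls (hP : IsMVIdeal P) (a : M) : hP.con.Quotient := (a : hP.con.Quotient)

instance (hP : IsMVIdeal P) : MVBase hP.con.Quotient where
  neg := Quotient.map' neg fun a b (h : a - b ∈ P ∧ b - a ∈ P) => by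
    change neg a - neg b ∈ P ∧ neg b - neg a ∈ P
    rw [neg_sub_neg, neg_sub_neg]
    exact ⟨h.2, h.1⟩
  mvNeg_neg a := by
    induction a using AddCon.induction_on with
    | H a => exact congrArg hP.cls (mvNeg_neg a)
  add_neg_zero a := by
    induction a using AddCon.induction_on with
    | H a => exact congrArg hP.cls (add_neg_zero a)
  luk a b := by
    induction a using AddCon.induction_on with
    | H a =>
      induction b using AddCon.induction_on with
      | H b => exact congrArg hP.cls (luk a b)

variable (hP : IsMVIdeal P)

theorem cls_add (a b : M) : hP.cls (a + b) = hP.cls a + hP.cls b := rfl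

theorem cls_neg (a : M) : hP.cls (neg a) = neg (hP.cls a) := rfl

theorem cls_zero : hP.cls 0 = 0 := rfl

theorem cls_mul (a b : M) : hP.cls (mvMul a b) = mvMul (hP.cls a) (hP.cls b) := rfl

theorem cls_eq_zero_iff : hP.cls a = 0 ↔ a ∈ P := by
  have : hP.cls a = 0 ↔ (a - 0 ∈ P ∧ 0 - a ∈ P) := hP.con.eq
  rw [this, tsub_zero, sub_eq_zero_iff.2 (zero_le : (0 : M) ≤ a)]
  exact ⟨fun h => h.1, fun h => ⟨h, hP.zero_mem⟩⟩

theorem cls_eq_one_iff : hP.cls a = neg 0 ↔ neg a ∈ P := by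
  rw [← cls_eq_zero_iff hP, cls_neg, ← mvNeg_injective.eq_iff, mvNeg_neg]

theorem isMVChain (hprime : ∀ a b, a - b ∈ P ∨ b - a ∈ P) : IsMVChain hP.con.Quotient := by
  intro a b
  induction a using AddCon.induction_on with
  | H a =>
    induction b using AddCon.induction_on with
    | H b =>
      rcases hprime (neg a) b with h | h
      · left
        have : hP.cls (a + b) = neg 0 := by rwa [cls_eq_one_iff, neg_sub_add]
        exact this
      · right
        have : hP.cls (mvMul a b) = 0 := by
          rwa [cls_eq_zero_iff, mvMul_comm, ← sub_neg]
        exact this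

end IsMVIdeal

/-! ### States from prime ideals. -/

/-- A state that is a homomorphism to the unit interval. -/
structure IsMVState (s : M → ℝ) : Prop where
  nonneg : ∀ a, 0 ≤ s a
  one : s (neg 0) = 1
  sub : ∀ a b, s (a - b) = max (s a - s b) 0

namespace IsMVState

variable {s : M → ℝ} (hs : IsMVState s)
include hs

theorem zero : s 0 = 0 := by
  have := hs.sub 0 0
  rwa [sub_self, max_self, sub_eq_zero_iff.2 le_rfl] at this

theorem mono (h : a ≤ b) : s a ≤ s b := by
  have := hs.sub a b
  rw [sub_eq_zero_iff.2 h, hs.zero] at this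
  linarith [le_max_left (s a - s b) 0]

theorem le_one (a : M) : s a ≤ 1 := hs.one ▸ hs.mono (le_neg_zero a)

theorem neg (a : M) : s (neg a) = 1 - s a := by
  rw [← neg_zero_sub, hs.sub, hs.one, max_eq_left (by linarith [hs.le_one a])]

theorem add (a b : M) : s (a + b) = min 1 (s a + s b) := by
  have h := hs.neg (a + b)
  rw [neg_sub_add, hs.sub, hs.neg] at h
  rcases le_total (1 - s a - s b) 0 with h2 | h2
  · rw [max_eq_right h2] at h
    rw [min_eq_left] <;> linarith
  · rw [max_eq_left h2] at h
    rw [min_eq_right] <;> linarith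

theorem nsmul_eq_zero (h : s a = 0) (n : ℕ) : s (n • a) = 0 := by
  induction n with
  | zero => rw [zero_nsmul, hs.zero]
  | succ n ih => rw [succ_nsmul, hs.add, ih, h]; norm_num

end IsMVState

/-- The state is pulled back from the quotient chain. If `N • a` stays short of the unit there, its
summands add without truncation, so `N * s a ≤ 1`. If `a` and `N • a` have nonzero product there,
their sum is the unit, which excludes `s a = 0`. -/
theorem IsMVIdeal.exists_state {P : Set M} (hP : IsMVIdeal P)
    (hprime : ∀ a b, a - b ∈ P ∨ b - a ∈ P) (h1 : neg 0 ∉ P) :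
    ∃ s : M → ℝ, IsMVState s ∧ (∀ (N : ℕ) a, neg (N • a) ∉ P → N * s a ≤ 1) ∧
      ∀ (N : ℕ) a, a - neg (N • a) ∉ P → 0 < s a := by
  have hC := hP.isMVChain hprime
  obtain ⟨t, ht0, ht1, hadd⟩ := hC.exists_state (by
    intro h
    exact h1 ((cls_eq_zero_iff hP).1 (by rw [cls_neg, cls_zero, ← h])))
  have tz : t 0 = 0 := by
    have := hadd 0 0 (by simp [mvMul])
    rw [add_zero] at this
    linarith
  have hcase : ∀ a b, a - b ∈ P → t (hP.cls b) = t (hP.cls a) + t (hP.cls (b - a)) := fun a b h => by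
    have h2 := congrArg hP.cls (sub_add_comm b a)
    rw [cls_add, cls_add, (cls_eq_zero_iff hP).2 h, zero_add, add_comm] at h2
    rw [← h2]
    apply hadd
    rw [← cls_mul, (mul_eq_zero_iff).2, cls_zero]
    rw [sub_def, mvNeg_neg, add_left_comm, neg_add_self, add_neg_zero]
  have hs : IsMVState fun a => t (hP.cls a) := by
    refine ⟨fun a => ht0 _, ht1, fun a b => ?_⟩
    rcases hprime a b with h | h
    · have h2 := hcase a b h
      have h3 := ht0 (hP.cls (b - a))
      simp only [(cls_eq_zero_iff hP).2 h, tz]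
      rw [max_eq_right]
      linarith
    · have h2 := hcase b a h
      have h3 := ht0 (hP.cls (a - b))
      rw [max_eq_left] <;> linarith
  refine ⟨_, hs, fun N a h => ?_, fun N a h => ?_⟩
  · have h2 : ∀ n ≤ N, t (hP.cls (n • a)) = n * t (hP.cls a) := by
      intro n
      induction n with
      | zero => intro _; rw [zero_nsmul, cls_zero, tz]; simp
      | succ n ih =>
        intro hn
        have h3 : mvMul (hP.cls (n • a)) (hP.cls a) = 0 := by
          refine (hC _ _).resolve_left fun h4 => h ?_
          rw [← cls_add, ← succ_nsmul, cls_eq_one_iff] at h4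
          exact hP.mem_of_le (neg_le_neg (nsmul_le_nsmul_left zero_le hn)) h4
        rw [succ_nsmul, cls_add, hadd _ _ h3, ih (by omega)]
        push_cast
        ring
    rw [← h2 N le_rfl]
    exact hs.le_one (N • a)
  · refine lt_of_le_of_ne (ht0 _) fun h0 => ?_
    rcases hC (hP.cls a) (hP.cls (N • a)) with h2 | h2
    · have h3 := hs.add a (N • a)
      rw [hs.nsmul_eq_zero h0.symm, ← h0] at h3
      rw [← cls_add] at h2
      simp only [h2, ht1] at h3
      norm_num at h3
    · rw [← cls_mul, cls_eq_zero_iff, ← sub_neg] at h2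
      exact h h2

/-- Take an ideal maximal among those missing every `c n`. If neither difference were in it,
adjoining each would capture some `c n`. At a common later index, `c n - (p + q)` lies below
multiples of both `a - b` and `b - a`, which are disjoint, so `c n` would be in `P`. -/
theorem exists_prime_ideal {c : ℕ → M} (hc : Antitone c) (h0 : ∀ n, c n ≠ 0) :
    ∃ P : Set M, IsMVIdeal P ∧ (∀ a b, a - b ∈ P ∨ b - a ∈ P) ∧ ∀ n, c n ∉ P := by
  obtain ⟨P, -, hmax⟩ := zorn_subset_nonempty {P : Set M | IsMVIdeal P ∧ ∀ n, c n ∉ P} (by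
    intro ch hch hchain hne
    refine ⟨⋃₀ ch, ⟨⟨?_, ?_, ?_⟩, ?_⟩, fun t ht => subset_sUnion_of_mem ht⟩
    · obtain ⟨t, ht⟩ := hne
      exact ⟨t, ht, (hch ht).1.zero_mem⟩
    · rintro a b ⟨t, ht, hat⟩ ⟨u, hu, hbu⟩
      rcases hchain.total ht hu with h | h
      · exact ⟨u, hu, (hch hu).1.add_mem (h hat) hbu⟩
      · exact ⟨t, ht, (hch ht).1.add_mem hat (h hbu)⟩
    · rintro a b hab ⟨t, ht, hbt⟩
      exact ⟨t, ht, (hch ht).1.mem_of_le hab hbt⟩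
    · rintro n ⟨t, ht, hnt⟩
      exact (hch ht).2 n hnt) {0} (by
    refine ⟨⟨rfl, ?_, ?_⟩, h0⟩
    · rintro a b rfl rfl
      exact add_zero _
    · rintro a b hab rfl
      exact nonpos_iff_eq_zero.1 hab)
  obtain ⟨hP, hcP⟩ := hmax.prop
  have key : ∀ x, x ∉ P → ∃ n, ∃ p ∈ P, ∃ k : ℕ, c n ≤ p + k • x := by
    intro x hx
    by_contra! hcon
    have hQ : {y | ∃ p ∈ P, ∃ k : ℕ, y ≤ p + k • x} ∈
        {P : Set M | IsMVIdeal P ∧ ∀ n, c n ∉ P} := by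
      refine ⟨⟨⟨0, hP.zero_mem, 0, by simp⟩, ?_, ?_⟩, ?_⟩
      · rintro a b ⟨p, hp, k, ha⟩ ⟨q, hq, l, hb⟩
        refine ⟨p + q, hP.add_mem hp hq, k + l, (add_le_add ha hb).trans_eq ?_⟩
        rw [add_nsmul]
        abel
      · rintro a b hab ⟨p, hp, k, hb⟩
        exact ⟨p, hp, k, hab.trans hb⟩
      · rintro n ⟨p, hp, k, hn⟩
        exact hcon n p hp k hn
    exact hx (hmax.le_of_ge hQ (fun p hp => ⟨p, hp, 0, by simp⟩)
      ⟨0, hP.zero_mem, 1, by simp⟩)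
  refine ⟨P, hP, fun a b => ?_, hcP⟩
  by_contra! h
  obtain ⟨m, p, hp, k, hk⟩ := key _ h.1
  obtain ⟨n, q, hq, l, hl⟩ := key _ h.2
  have h1 : c (max m n) - (p + q) ≤ k • (a - b) := by
    rw [tsub_le_iff_left]
    refine (hc (le_max_left m n)).trans (hk.trans ?_)
    gcongr
    exact le_self_add
  have h2 : c (max m n) - (p + q) ≤ l • (b - a) := by
    rw [tsub_le_iff_left]
    refine (hc (le_max_right m n)).trans (hl.trans ?_)
    gcongr
    exact le_add_self
  have h3 := eq_zero_of_le_nsmul (x := b - a) (y := k • (a - b)) (fun z hz hz2 =>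
    eq_zero_of_le_nsmul (x := a - b) (y := b - a) (fun w hw hw2 =>
      eq_zero_of_le_sub_of_le_sub hw hw2) k z hz2 hz) l _ h2 h1
  exact hcP _ (hP.mem_of_le (sub_eq_zero_iff.1 h3) (hP.add_mem hp hq))

/-- Multiples of the members of a decreasing null sequence do not dominate a nonzero element. -/
theorem exists_sub_nsmul_ne_zero {d : ℕ → M} (hd : Antitone d) (h0 : IsGLB (range d) 0) (N : ℕ) :
    ∀ c : M, c ≠ 0 → ∃ n, c - N • d n ≠ 0 := by
  induction N with
  | zero => intro c hc; exact ⟨0, by simpa using hc⟩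
  | succ N ih =>
    intro c hc
    -- Otherwise `c` would be a lower bound of the sequence. The induction then runs on `c - d m`,
    -- and a later index serves both steps.
    obtain ⟨m, hm⟩ : ∃ m, c - d m ≠ 0 := by
      by_contra! h
      refine hc (nonpos_iff_eq_zero.1 (h0.2 ?_))
      rintro _ ⟨n, rfl⟩
      exact sub_eq_zero_iff.1 (h n)
    obtain ⟨n, hn⟩ := ih _ hm
    refine ⟨max m n, fun h => hn ?_⟩
    rw [sub_eq_zero_iff, succ_nsmul, ← tsub_le_iff_right] at h
    rw [sub_eq_zero_iff]
    calc c - d m ≤ c - d (max m n) := tsub_le_tsub_left (hd (le_max_left m n)) c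
      _ ≤ N • d (max m n) := h
      _ ≤ N • d n := nsmul_le_nsmul_right (hd (le_max_right m n)) N

/-- `σ`-complete MV-algebras are Archimedean. -/
theorem exists_sub_neg_nsmul_ne_zero (hσ : ∀ a : ℕ → M, ∃ s, IsLUB (range a) s) (hc : c ≠ 0) :
    ∃ N : ℕ, c - neg (N • c) ≠ 0 := by
  by_contra! h
  obtain ⟨w, hw⟩ := hσ fun n => n • c
  -- If the claim fails, every `n • c` is orthogonal to `c`, so `n • c = (n + 1) • c - c ≤ w - c`.
  -- Thus `w ≤ w - c`, which forces `c = 0`.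
  have h1 : w ≤ w - c := hw.2 (by
    rintro _ ⟨n, rfl⟩
    have h2 : (n + 1) • c ≤ w := hw.1 ⟨n + 1, rfl⟩
    have h3 := add_sub_cancel_of_le (a := c) (b := n • c) (by
      rw [← neg_le_neg_iff, mvNeg_neg]; exact sub_eq_zero_iff.1 (h n))
    change n • c ≤ w - c
    rw [← h3, add_comm, ← succ_nsmul]
    exact tsub_le_tsub_right h2 c)
  have h2 : c ≤ w := hw.1 ⟨1, one_nsmul c⟩
  have h3 := sub_sub_of_le h2
  rw [sub_eq_zero_iff.2 h1] at h3
  exact hc h3.symm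

/-- There are enough states that respect countably many decreasing null sequences. -/
theorem exists_state_tendsto (hσ : ∀ a : ℕ → M, ∃ s, IsLUB (range a) s) {d : ℕ → ℕ → M}
    (hd : ∀ i, Antitone (d i)) (h0 : ∀ i, IsGLB (range (d i)) 0) (hc : c ≠ 0) :
    ∃ s : M → ℝ, IsMVState s ∧ 0 < s c ∧ ∀ i, Tendsto (fun n => s (d i n)) atTop (𝓝 0) := by
  obtain ⟨K, hK⟩ := exists_sub_neg_nsmul_ne_zero hσ hc
  have step : ∀ (k : ℕ) (u : {u : M // u ≠ 0}), ∃ n,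
      u.1 - k.unpair.2 • d k.unpair.1 n ≠ 0 := fun k u =>
    exists_sub_nsmul_ne_zero (hd _) (h0 _) _ u.1 u.2
  choose f hf using step
  -- Stage `k` codes a pair `(i, N)` and subtracts `N • d i n`, with `n` chosen so that the result
  -- stays nonzero. A prime ideal missing all stages gives `N * s (d i n) ≤ 1` for every pair, and
  -- missing the initial element gives `0 < s c`.
  let g : ℕ → {u : M // u ≠ 0} := fun n =>
    Nat.rec ⟨_, hK⟩ (fun k u => ⟨u.1 - k.unpair.2 • d k.unpair.1 (f k u), hf k u⟩) n
  have hg : ∀ k, (g (k + 1)).1 = (g k).1 - k.unpair.2 • d k.unpair.1 (f k (g k)) := fun k => rfl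
  obtain ⟨P, hP, hprime, hgP⟩ := exists_prime_ideal (c := fun k => (g k).1)
    (antitone_nat_of_succ_le fun k => by rw [hg]; exact tsub_le_self) (fun k => (g k).2)
  obtain ⟨s, hs, hs1, hs2⟩ := hP.exists_state hprime fun h =>
    hgP 0 (hP.mem_of_le (le_neg_zero _) h)
  refine ⟨s, hs, hs2 K c (hgP 0), fun i => ?_⟩
  have key : ∀ N : ℕ, ∃ n, N * s (d i n) ≤ 1 := fun N => by
    have h := hg (Nat.pair i N)
    rw [Nat.unpair_pair] at h
    refine ⟨f (Nat.pair i N) (g (Nat.pair i N)), hs1 N _ fun h2 => hgP (Nat.pair i N + 1) ?_⟩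
    rw [h]
    refine hP.mem_of_le ?_ h2
    rw [← neg_zero_sub]
    exact tsub_le_tsub_right (le_neg_zero _) _
  rw [Metric.tendsto_atTop]
  intro ε hε
  obtain ⟨N, hN⟩ := exists_nat_gt (1 / ε)
  obtain ⟨n, hn⟩ := key N
  refine ⟨n, fun m hm => ?_⟩
  rw [Real.dist_eq, sub_zero, abs_of_nonneg (hs.nonneg _)]
  have h1 := hs.mono (hd i hm)
  have hN0 : (0 : ℝ) < N := lt_trans (by positivity) hN
  rw [div_lt_iff₀ hε] at hN
  by_contra! h2
  have : N * ε ≤ N * s (d i n) := mul_le_mul_of_nonneg_left (h2.trans h1) hN0.le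
  linarith

end MVAlgebra

/-! ### Blocks as MV-algebras. -/

namespace EffectAlgebra.IsBlock

variable {E : Type*} [EffectAlgebra E] [Fact (IsSigmaLattice E)] {B : Set E}

/-- A block of a `σ`-lattice effect algebra is an MV-algebra. -/
noncomputable abbrev mvAlgebra (hB : IsBlock B) : MVAlgebra B :=
  letI : Zero B := ⟨⟨0, hB.zero_mem⟩⟩
  letI : Add B := ⟨fun a b => ⟨oadd a.1 b.1, hB.oadd_mem a.2 b.2⟩⟩
  { (inferInstance : PartialOrder B) with
    neg a := ⟨compl a.1, hB.compl_mem a.2⟩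
    nsmul := nsmulRec
    add_comm a b := Subtype.ext (oadd_comm (hB.compat (hB.compl_mem a.2) b.2))
    add_zero a := Subtype.ext (oadd_eq_of_padd (padd_zero a.1))
    zero_add a := Subtype.ext (oadd_eq_of_padd (zero_padd a.1))
    add_assoc a b c := Subtype.ext (by
      change oadd (oadd a.1 b.1) c.1 = oadd a.1 (oadd b.1 c.1)
      conv_rhs => rw [oadd, hB.osub_oadd (hB.compl_mem a.2) b.2 c.2]
      conv_lhs => rw [oadd, oadd, compl_compl])
    mvNeg_neg a := Subtype.ext (compl_compl a.1)
    add_neg_zero a := Subtype.ext (by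
      change oadd a.1 (compl 0) = compl 0
      rw [oadd_comm (hB.compat (hB.compl_mem a.2) (hB.compl_mem hB.zero_mem)), oadd, compl_compl,
        osub_eq_zero_iff.2 (zero_le a.1)])
    luk a b := Subtype.ext (by
      change oadd (compl (oadd (compl a.1) b.1)) b.1 = oadd (compl (oadd (compl b.1) a.1)) a.1
      rw [compl_oadd_compl, compl_oadd_compl, (hB.compat a.2 b.2).oadd_osub,
        (hB.compat b.2 a.2).oadd_osub, sup_comm])
    le_iff a b := by
      rw [Subtype.ext_iff]
      change a.1 ≤ b.1 ↔ oadd (compl a.1) b.1 = compl 0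
      rw [oadd, compl_compl, ← osub_eq_zero_iff]
      exact ⟨fun h => by rw [h], fun h => by rw [← compl_compl (osub a.1 b.1), h, compl_compl]⟩ }

end EffectAlgebra.IsBlock

/-! ### From resolutions to measures and Borel sets. -/

/-- A distribution function that is `0` near `-∞` and `1` near `∞` comes from a probability measure,
with the expected value at each half-line that ends at a point of left continuity. -/
theorem exists_probabilityMeasure_Iio {g : ℝ → ℝ} (hg : Monotone g) {a b : ℝ}
    (ha : ∀ t ≤ a, g t = 0) (hb : ∀ t, b < t → g t = 1) :
    ∃ μ : Measure ℝ, IsProbabilityMeasure μ ∧ ∀ t,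
      Tendsto (fun n : ℕ => g (t - 1 / (n + 1))) atTop (𝓝 (g t)) → μ.real (Iio t) = g t := by
  have hle : ∀ t, g t ≤ hg.stieltjesFunction t := fun t => hg.le_rightLim le_rfl
  have hle2 : ∀ u t, u < t → hg.stieltjesFunction u ≤ g t := fun u t h => hg.rightLim_le h
  have hbot : Tendsto hg.stieltjesFunction atBot (𝓝 0) := by
    refine tendsto_const_nhds.congr' ?_
    filter_upwards [Iio_mem_atBot a] with t ht
    refine le_antisymm ?_ ((hle2 t a ht).trans_eq (ha a le_rfl))
    rw [← ha t (le_of_lt ht)]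
    exact hle t
  have htop : Tendsto hg.stieltjesFunction atTop (𝓝 1) := by
    refine tendsto_const_nhds.congr' ?_
    filter_upwards [Ioi_mem_atTop b] with t ht
    have ht' : b < t := ht
    refine le_antisymm ?_ ((hle2 t (t + 1) (by linarith)).trans_eq (hb _ (by linarith)))
    rw [← hb t ht]
    exact hle t
  refine ⟨hg.stieltjesFunction.measure, hg.stieltjesFunction.isProbabilityMeasure hbot htop,
    fun t ht => ?_⟩
  have hlim : Tendsto (fun n : ℕ => t - 1 / ((n : ℝ) + 1)) atTop (𝓝[<] t) := by
    rw [tendsto_nhdsWithin_iff]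
    refine ⟨?_, Eventually.of_forall fun n => ?_⟩
    · simpa using tendsto_const_nhds.sub (tendsto_one_div_add_atTop_nhds_zero_nat (𝕜 := ℝ))
    · have : (0 : ℝ) < 1 / ((n : ℝ) + 1) := by positivity
      simp only [mem_Iio]
      linarith
  -- The Stieltjes function is the right-continuous version of `g`; its left limit at `t` is
  -- squeezed to `g t` along `t - 1 / (n + 1)`.
  have h1 := (hg.stieltjesFunction.mono.tendsto_leftLim t).comp hlim
  have h2 : Tendsto (fun n : ℕ => hg.stieltjesFunction (t - 1 / ((n : ℝ) + 1))) atTop (𝓝 (g t)) := by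
    refine tendsto_of_tendsto_of_tendsto_of_le_of_le ht tendsto_const_nhds (fun n => hle _)
      fun n => hle2 _ _ ?_
    have : (0 : ℝ) < 1 / ((n : ℝ) + 1) := by positivity
    linarith
  have h3 := tendsto_nhds_unique h1 h2
  rw [measureReal_def, StieltjesFunction.measure_Iio _ hbot, h3, sub_zero, ENNReal.toReal_ofReal]
  rw [← ha (min a t) (min_le_left a t)]
  exact hg (min_le_right a t)

namespace MVAlgebra

variable {M : Type*} [MVAlgebra M]

/-- The null sequences. -/
def IsNull (d : ℕ → M) : Prop := Antitone d ∧ IsGLB (range d) 0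

/-- A lower bound `z` of the differences gives `e n ≤ a - z` for all `n`, hence `a ≤ a - z` and `z =
0`. -/
theorem isNull_sub {e : ℕ → M} {a : M} (he : Monotone e) (ha : IsLUB (range e) a) :
    IsNull fun n => a - e n := by
  refine ⟨fun m n h => tsub_le_tsub_left (he h) a, fun x _ => zero_le, fun z hz => ?_⟩
  have hz' : ∀ n, z ≤ a - e n := fun n => hz ⟨n, rfl⟩
  have h1 : a ≤ a - z := ha.2 (by
    rintro _ ⟨n, rfl⟩
    rw [← sub_sub_of_le (ha.1 ⟨n, rfl⟩)]
    exact tsub_le_tsub_left (hz' n) a)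
  have h2 := sub_sub_of_le ((hz' 0).trans tsub_le_self)
  rw [sub_eq_zero_iff.2 h1] at h2
  exact h2.symm.le

theorem exists_state_of_countable (hσ : ∀ a : ℕ → M, ∃ s, IsLUB (range a) s) {D : Set (ℕ → M)}
    (hD : D.Countable) (hnull : ∀ d ∈ D, IsNull d) {c : M} (hc : c ≠ 0) :
    ∃ s : M → ℝ, IsMVState s ∧ 0 < s c ∧ ∀ d ∈ D, Tendsto (fun n => s (d n)) atTop (𝓝 0) := by
  -- The zero sequence is added so that an empty `D` can be enumerated too.
  obtain ⟨f, hf⟩ := (hD.insert fun _ => (0 : M)).exists_eq_range (insert_nonempty _ _)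
  have hf2 : ∀ i, IsNull (f i) := fun i => by
    have : f i ∈ insert (fun _ => (0 : M)) D := hf ▸ mem_range_self i
    rcases this with h | h
    · rw [h]
      exact ⟨antitone_const, fun x _ => zero_le, fun z hz => hz ⟨0, rfl⟩⟩
    · exact hnull _ h
  obtain ⟨s, hs, hsc, hlim⟩ := exists_state_tendsto hσ (fun i => (hf2 i).1) (fun i => (hf2 i).2) hc
  refine ⟨s, hs, hsc, fun d hd => ?_⟩
  obtain ⟨i, rfl⟩ : d ∈ range f := hf ▸ mem_insert_of_mem _ hd
  exact hlim i

/-- The element `e` represents the set `A`: its value is the measure of `A` under all states that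
respect some countable family of null sequences. -/
def Represents (μ : (M → ℝ) → Measure ℝ) (A : Set ℝ) (e : M) : Prop :=
  ∃ D : Set (ℕ → M), D.Countable ∧ (∀ d ∈ D, IsNull d) ∧ ∀ s, IsMVState s →
    (∀ d ∈ D, Tendsto (fun n => s (d n)) atTop (𝓝 0)) → (μ s).real A = s e

namespace Represents

variable {μ : (M → ℝ) → Measure ℝ} {A B : Set ℝ} {e f : M}

/-- If `e - f ≠ 0`, some state respecting both countable families is positive on it, against
monotonicity of its measure. -/
theorem mono (hσ : ∀ a : ℕ → M, ∃ s, IsLUB (range a) s)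
    (hμ : ∀ s, IsMVState s → IsProbabilityMeasure (μ s)) (h : Represents μ A e)
    (h2 : Represents μ B f) (hAB : A ⊆ B) : e ≤ f := by
  obtain ⟨D, hD, hDn, hDs⟩ := h
  obtain ⟨D', hD', hDn', hDs'⟩ := h2
  by_contra hcon
  rw [← sub_eq_zero_iff] at hcon
  obtain ⟨s, hs, hpos, hlim⟩ := exists_state_of_countable hσ (hD.union hD') (by
    rintro d (hd | hd)
    · exact hDn d hd
    · exact hDn' d hd) hcon
  have := hμ s hs
  rw [hs.sub, ← hDs s hs fun d hd => hlim d (Or.inl hd),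
    ← hDs' s hs fun d hd => hlim d (Or.inr hd),
    max_eq_right (sub_nonpos.2 (measureReal_mono hAB))] at hpos
  exact lt_irrefl _ hpos

theorem unique (hσ : ∀ a : ℕ → M, ∃ s, IsLUB (range a) s)
    (hμ : ∀ s, IsMVState s → IsProbabilityMeasure (μ s)) (h : Represents μ A e)
    (h2 : Represents μ A f) : e = f :=
  le_antisymm (h.mono hσ hμ h2 subset_rfl) (h2.mono hσ hμ h subset_rfl)

theorem univ (hμ : ∀ s, IsMVState s → IsProbabilityMeasure (μ s)) :
    Represents μ univ (neg 0) := by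
  refine ⟨∅, countable_empty, by simp, fun s hs _ => ?_⟩
  have := hμ s hs
  rw [hs.one, probReal_univ]

theorem compl (hμ : ∀ s, IsMVState s → IsProbabilityMeasure (μ s)) (hA : MeasurableSet A)
    (h : Represents μ A e) : Represents μ Aᶜ (neg e) := by
  obtain ⟨D, hD, hDn, hDs⟩ := h
  refine ⟨D, hD, hDn, fun s hs hlim => ?_⟩
  have := hμ s hs
  rw [probReal_compl_eq_one_sub hA, hs.neg, hDs s hs hlim]

theorem union (hμ : ∀ s, IsMVState s → IsProbabilityMeasure (μ s)) (hB : MeasurableSet B)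
    (hAB : Disjoint A B) (h : Represents μ A e) (h2 : Represents μ B f) :
    Represents μ (A ∪ B) (e + f) := by
  obtain ⟨D, hD, hDn, hDs⟩ := h
  obtain ⟨D', hD', hDn', hDs'⟩ := h2
  refine ⟨D ∪ D', hD.union hD', ?_, fun s hs hlim => ?_⟩
  · rintro d (hd | hd)
    · exact hDn d hd
    · exact hDn' d hd
  have := hμ s hs
  rw [hs.add, ← hDs s hs fun d hd => hlim d (Or.inl hd),
    ← hDs' s hs fun d hd => hlim d (Or.inr hd), ← measureReal_union hAB hB, min_eq_right]
  exact measureReal_le_one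

/-- Adding the null sequence `a - e n` to the countable families forces the admissible states to
preserve this one supremum. -/
theorem iUnion (hσ : ∀ a : ℕ → M, ∃ s, IsLUB (range a) s)
    (hμ : ∀ s, IsMVState s → IsProbabilityMeasure (μ s)) {A : ℕ → Set ℝ} {e : ℕ → M} {a : M}
    (hA : Monotone A) (h : ∀ n, Represents μ (A n) (e n)) (ha : IsLUB (range e) a) :
    Represents μ (⋃ n, A n) a := by
  have he : Monotone e := fun m n hmn => (h m).mono hσ hμ (h n) (hA hmn)
  choose D hD hDn hDs using h
  refine ⟨insert (fun n => a - e n) (⋃ n, D n), (countable_iUnion hD).insert _, ?_,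
    fun s hs hlim => ?_⟩
  · rintro d (rfl | hd)
    · exact isNull_sub he ha
    · obtain ⟨n, hn⟩ := mem_iUnion.1 hd
      exact hDn n d hn
  have := hμ s hs
  have h1 : Tendsto (fun n => (μ s).real (A n)) atTop (𝓝 ((μ s).real (⋃ n, A n))) :=
    (ENNReal.tendsto_toReal (measure_ne_top _ _)).comp (tendsto_measure_iUnion_atTop hA)
  refine tendsto_nhds_unique h1 ?_
  have h2 := hlim _ (mem_insert _ _)
  have h3 : Tendsto (fun n => s a - s (a - e n)) atTop (𝓝 (s a)) := by
    simpa using tendsto_const_nhds.sub h2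
  refine h3.congr fun n => ?_
  rw [hs.sub, max_eq_left (sub_nonneg.2 (hs.mono (ha.1 ⟨n, rfl⟩))),
    hDs n s hs fun d hd => hlim d (mem_insert_of_mem _ (mem_iUnion.2 ⟨n, hd⟩))]
  ring

end Represents

/-- Bounded spectral resolutions in a `σ`-complete MV-algebra extend to the Borel sets. -/
theorem exists_measure_of_resolution (hσ : ∀ a : ℕ → M, ∃ s, IsLUB (range a) s) {F : ℝ → M}
    (hF : ∀ t, IsLUB (F '' Iio t) (F t)) {a b : ℝ} (ha : ∀ t ≤ a, F t = 0)
    (hb : ∀ t, b < t → F t = neg 0) :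
    ∃ x : BorelSet → M, x ⟨univ, MeasurableSet.univ⟩ = neg 0 ∧
      (∀ A B : BorelSet, Disjoint A.1 B.1 → x A ≤ neg (x B) ∧
        x ⟨A.1 ∪ B.1, A.2.union B.2⟩ = x A + x B) ∧
      (∀ A : ℕ → BorelSet, (∀ i, (A i).1 ⊆ (A (i + 1)).1) →
        IsLUB (range fun i => x (A i)) (x ⟨⋃ i, (A i).1, MeasurableSet.iUnion fun i => (A i).2⟩)) ∧
      ∀ t, x ⟨Iio t, measurableSet_Iio⟩ = F t := by
  have hmono : Monotone F := fun u t h => by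
    rcases h.eq_or_lt with rfl | h
    · exact le_rfl
    · exact (hF t).1 ⟨u, h, rfl⟩
  have hex : ∀ s : M → ℝ, ∃ μ : Measure ℝ, IsMVState s → IsProbabilityMeasure μ ∧ ∀ t,
      Tendsto (fun n : ℕ => s (F (t - 1 / (n + 1)))) atTop (𝓝 (s (F t))) →
        μ.real (Iio t) = s (F t) := fun s => by
    by_cases hs : IsMVState s
    · obtain ⟨μ, h⟩ := exists_probabilityMeasure_Iio (g := fun t => s (F t)) (a := a) (b := b)
        (fun u t h => hs.mono (hmono h)) (fun t ht => by rw [ha t ht, hs.zero])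
        (fun t ht => by rw [hb t ht, hs.one])
      exact ⟨μ, fun _ => h⟩
    · exact ⟨0, fun h => absurd h hs⟩
  choose μ hμ' using hex
  have hμ : ∀ s, IsMVState s → IsProbabilityMeasure (μ s) := fun s hs => (hμ' s hs).1
  have hIio : ∀ t, Represents μ (Iio t) (F t) := fun t => by
    have hseq : Monotone fun n : ℕ => t - 1 / ((n : ℝ) + 1) := fun m n h => by
      have : (1 : ℝ) / ((n : ℝ) + 1) ≤ 1 / ((m : ℝ) + 1) := by gcongr
      simp only
      linarith
    have hlub : IsLUB (range fun n : ℕ => F (t - 1 / ((n : ℝ) + 1))) (F t) := by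
      refine ⟨?_, fun w hw => (hF t).2 ?_⟩
      · rintro _ ⟨n, rfl⟩
        have : (0 : ℝ) < 1 / ((n : ℝ) + 1) := by positivity
        exact hmono (by linarith)
      · rintro _ ⟨u, hu, rfl⟩
        have hu' : u < t := hu
        obtain ⟨n, hn⟩ := exists_nat_one_div_lt (sub_pos.2 hu')
        exact (hmono (by linarith)).trans (hw ⟨n, rfl⟩)
    -- Respecting this single null sequence makes `s ∘ F` left-continuous at `t`, so that the
    -- measure of `Iio t` is `s (F t)`.
    refine ⟨{fun n : ℕ => F t - F (t - 1 / ((n : ℝ) + 1))}, countable_singleton _, ?_,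
      fun s hs hlim => (hμ' s hs).2 t ?_⟩
    · rintro d rfl
      exact isNull_sub (fun m n h => hmono (hseq h)) hlub
    · have h2 := hlim _ (mem_singleton _)
      have h3 : Tendsto (fun n : ℕ => s (F t) - s (F t - F (t - 1 / ((n : ℝ) + 1)))) atTop
          (𝓝 (s (F t))) := by
        simpa using tendsto_const_nhds.sub h2
      refine h3.congr fun n => ?_
      rw [hs.sub, max_eq_left (sub_nonneg.2 (hs.mono (hlub.1 ⟨n, rfl⟩)))]
      ring
  have hall : ∀ A : Set ℝ, MeasurableSet A → ∃ e, Represents μ A e := by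
    refine MeasurableSpace.induction_on_inter
      (BorelSpace.measurable_eq.trans (borel_eq_generateFrom_Iio ℝ)) isPiSystem_Iio ?_ ?_ ?_ ?_
    · have := (Represents.univ hμ).compl hμ MeasurableSet.univ
      rw [compl_univ] at this
      exact ⟨_, this⟩
    · rintro _ ⟨t, rfl⟩
      exact ⟨_, hIio t⟩
    · rintro A hA ⟨e, he⟩
      exact ⟨_, he.compl hμ hA⟩
    · intro A hdisj hA h
      -- Finite partial unions replace the disjoint sequence by an increasing one.
      have hpart : ∀ n, ∃ e, Represents μ (⋃ i < n, A i) e := by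
        intro n
        induction n with
        | zero =>
          have := (Represents.univ hμ).compl hμ MeasurableSet.univ
          exact ⟨_, by simpa using this⟩
        | succ n ih =>
          obtain ⟨e, he⟩ := ih
          obtain ⟨f, hf⟩ := h n
          rw [biUnion_lt_succ]
          refine ⟨_, he.union hμ (hA n) ?_ hf⟩
          rw [disjoint_iUnion₂_left]
          exact fun i hi => hdisj hi.ne
      choose e he using hpart
      obtain ⟨w, hw⟩ := hσ e
      have := Represents.iUnion hσ hμ (fun m n hmn =>
        biUnion_subset_biUnion_left fun i (hi : i < m) => lt_of_lt_of_le hi hmn) he hw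
      have hU : ⋃ n, ⋃ i < n, A i = ⋃ n, A n := by
        ext r
        simp only [mem_iUnion]
        exact ⟨fun ⟨_, i, _, hi⟩ => ⟨i, hi⟩, fun ⟨i, hi⟩ => ⟨i + 1, i, by omega, hi⟩⟩
      rw [hU] at this
      exact ⟨w, this⟩
  choose x hx using fun A : BorelSet => hall A.1 A.2
  refine ⟨x, (hx _).unique hσ hμ (Represents.univ hμ), fun A B hAB => ⟨?_, ?_⟩, fun A hA => ?_,
    fun t => (hx _).unique hσ hμ (hIio t)⟩
  · exact (hx A).mono hσ hμ ((hx B).compl hμ B.2) hAB.subset_compl_right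
  · exact (hx _).unique hσ hμ ((hx A).union hμ B.2 hAB (hx B))
  · obtain ⟨w, hw⟩ := hσ fun i => x (A i)
    have := Represents.iUnion hσ hμ (monotone_nat_of_le_succ hA) (fun n => hx (A n)) hw
    rwa [(hx ⟨⋃ i, (A i).1, MeasurableSet.iUnion fun i => (A i).2⟩).unique hσ hμ this]

end MVAlgebra

/-! ### Existence of observables with a given resolution. -/

/-- Bounded spectral resolutions in a `σ`-lattice effect algebra belong to observables. -/
theorem EffectAlgebra.IsSigmaLattice.exists_observable {E : Type*} [EffectAlgebra E]
    (hE : IsSigmaLattice E) {F : ℝ → E} (hF : ∀ t, IsLUB (F '' Iio t) (F t)) {a b : ℝ}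
    (ha : ∀ t ≤ a, F t = 0) (hb : ∀ t, b < t → F t = 1) :
    ∃ x : Observable E, x.resolution = F := by
  have : Fact (IsSigmaLattice E) := ⟨hE⟩
  have hmono : Monotone F := fun u t h => by
    rcases h.eq_or_lt with rfl | h
    · exact le_rfl
    · exact (hF t).1 ⟨u, h, rfl⟩
  obtain ⟨B, hsB, hB⟩ := exists_isBlock (s := range F) (by
    rintro _ ⟨u, rfl⟩ _ ⟨t, rfl⟩
    rcases le_total u t with h | h
    · exact compat_of_le (hmono h)
    · exact compat_of_ge (hmono h))
  let := hB.mvAlgebra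
  -- Blocks contain the suprema of their subsets, so suprema taken in `E` are also suprema in `B`.
  have hlub : ∀ (s : Set B) (w : E) (hw : IsLUB (Subtype.val '' s) w),
      ∃ hwB : w ∈ B, IsLUB s ⟨w, hwB⟩ := fun s w hw => by
    refine ⟨hB.isLUB_mem (by rintro _ ⟨y, -, rfl⟩; exact y.2) hw, fun y hy => hw.1 ⟨y, hy, rfl⟩,
      fun y hy => hw.2 ?_⟩
    rintro _ ⟨z, hz, rfl⟩
    exact hy hz
  have hσ : ∀ c : ℕ → B, ∃ s, IsLUB (range c) s := fun c => by
    obtain ⟨w, hw⟩ := (hE fun n => (c n).1).1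
    obtain ⟨hwB, h⟩ := hlub (range c) w (by rw [← range_comp]; exact hw)
    exact ⟨_, h⟩
  have hone : (neg 0 : B).1 = 1 := compl_zero
  obtain ⟨x, hx1, hx2, hx3, hx4⟩ := MVAlgebra.exists_measure_of_resolution hσ
    (F := fun t => (⟨F t, hsB ⟨t, rfl⟩⟩ : B)) (a := a) (b := b) (fun t => by
      obtain ⟨_, h⟩ := hlub ((fun t => (⟨F t, hsB ⟨t, rfl⟩⟩ : B)) '' Iio t) (F t) (by
        rw [image_image]; exact hF t)
      exact h) (fun t ht => Subtype.ext (ha t ht))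
      (fun t ht => Subtype.ext ((hb t ht).trans hone.symm))
  refine ⟨⟨fun A => (x A).1, by rw [hx1, hone], fun A C hAC => ?_, fun A hA => ?_⟩, ?_⟩
  · obtain ⟨h1, h2⟩ := hx2 A C hAC
    obtain ⟨c, hc⟩ := le_compl_iff.1 (show (x A).1 ≤ compl (x C).1 from h1)
    rw [h2, hc]
    exact congrArg some (oadd_eq_of_padd hc).symm
  · obtain ⟨w, hw⟩ := (hE fun n => (x (A n)).1).1
    obtain ⟨hwB, h⟩ := hlub (range fun n => x (A n)) w (by rw [← range_comp]; exact hw)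
    rw [(hx3 A hA).unique h]
    exact hw
  · funext t
    exact congrArg Subtype.val (hx4 t)

theorem EffectAlgebra.IsSigmaLattice.exists_of_countable {E : Type*} [EffectAlgebra E]
    (hE : IsSigmaLattice E) {s : Set E} (hs : s.Countable) (hne : s.Nonempty) :
    (∃ a, IsLUB s a) ∧ ∃ a, IsGLB s a := by
  obtain ⟨f, rfl⟩ := hs.exists_eq_range hne
  exact hE f

/-! ### Null sets, resolutions and spectra of observables. -/

namespace Observable

variable {E : Type*} [EffectAlgebra E] (x : Observable E)

theorem toFun_mono {A B : BorelSet} (h : A.1 ⊆ B.1) : x.toFun A ≤ x.toFun B := by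
  have h2 := x.map_union A ⟨B.1 \ A.1, B.2.diff A.2⟩ disjoint_sdiff_right
  have h3 : (⟨A.1 ∪ B.1 \ A.1, A.2.union (B.2.diff A.2)⟩ : BorelSet) = B :=
    Subtype.ext (union_sdiff_cancel h)
  rw [h3] at h2
  exact ⟨_, h2⟩

theorem toFun_compl (A : BorelSet) : x.toFun ⟨A.1ᶜ, A.2.compl⟩ = EffectAlgebra.compl (x.toFun A) := by
  have h2 := x.map_union A ⟨A.1ᶜ, A.2.compl⟩ disjoint_compl_right
  have h3 : (⟨A.1 ∪ A.1ᶜ, A.2.union A.2.compl⟩ : BorelSet) = ⟨univ, MeasurableSet.univ⟩ :=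
    Subtype.ext (union_compl_self _)
  rw [h3, x.map_univ] at h2
  exact (compl_eq_of_padd h2).symm

theorem toFun_empty : x.toFun ⟨∅, MeasurableSet.empty⟩ = 0 := by
  have := x.toFun_compl ⟨univ, MeasurableSet.univ⟩
  rw [x.map_univ, compl_one] at this
  rw [← this]
  exact congrArg _ (Subtype.ext compl_univ.symm)

theorem toFun_compl_eq_zero_iff (A : BorelSet) :
    x.toFun ⟨A.1ᶜ, A.2.compl⟩ = 0 ↔ x.toFun A = 1 := by
  rw [toFun_compl]
  constructor
  · intro h
    rw [← EffectAlgebra.compl_compl (x.toFun A), h, compl_zero]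
  · intro h
    rw [h, compl_one]

theorem toFun_union_eq_zero {A B : BorelSet} (hA : x.toFun A = 0) (hB : x.toFun B = 0) :
    x.toFun ⟨A.1 ∪ B.1, A.2.union B.2⟩ = 0 := by
  have h1 : x.toFun ⟨B.1 \ A.1, B.2.diff A.2⟩ = 0 :=
    eq_zero_of_le (hB ▸ x.toFun_mono (sdiff_subset : B.1 \ A.1 ⊆ B.1))
  have h2 := x.map_union A ⟨B.1 \ A.1, B.2.diff A.2⟩ disjoint_sdiff_right
  rw [hA, h1, padd_zero] at h2
  rw [Option.some.inj h2]
  exact congrArg _ (Subtype.ext union_sdiff_self.symm)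

theorem toFun_iUnion_eq_zero {A : ℕ → BorelSet} (hA : ∀ n, x.toFun (A n) = 0) :
    x.toFun ⟨⋃ n, (A n).1, MeasurableSet.iUnion fun n => (A n).2⟩ = 0 := by
  have hm : ∀ n, MeasurableSet (⋃ i < n, (A i).1) := fun n =>
    MeasurableSet.iUnion fun i => MeasurableSet.iUnion fun _ => (A i).2
  have h0 : ∀ n, x.toFun ⟨⋃ i < n, (A i).1, hm n⟩ = 0 := fun n => by
    induction n with
    | zero =>
      rw [← x.toFun_empty]
      exact congrArg _ (Subtype.ext (by simp))
    | succ n ih =>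
      rw [← x.toFun_union_eq_zero ih (hA n)]
      exact congrArg _ (Subtype.ext (biUnion_lt_succ _ n))
  have h1 := x.map_iUnion (fun n => ⟨⋃ i < n, (A i).1, hm n⟩) fun n =>
    biUnion_subset_biUnion_left fun i (hi : i < n) => hi.trans (Nat.lt_succ_self n)
  have h2 : (⟨⋃ n, ⋃ i < n, (A i).1, MeasurableSet.iUnion hm⟩ : BorelSet) =
      ⟨⋃ n, (A n).1, MeasurableSet.iUnion fun n => (A n).2⟩ := Subtype.ext (by
    ext r
    simp only [mem_iUnion]
    exact ⟨fun ⟨_, i, _, hi⟩ => ⟨i, hi⟩, fun ⟨i, hi⟩ => ⟨i + 1, i, by omega, hi⟩⟩)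
  rw [← h2]
  refine eq_zero_of_le (h1.2 ?_)
  rintro _ ⟨n, rfl⟩
  exact (h0 n).le

theorem resolution_mono : Monotone x.resolution := fun _ _ h => x.toFun_mono (Iio_subset_Iio h)

theorem isLUB_resolution (t : ℝ) : IsLUB (x.resolution '' Iio t) (x.resolution t) := by
  refine ⟨?_, fun w hw => ?_⟩
  · rintro _ ⟨u, hu, rfl⟩
    exact x.resolution_mono (le_of_lt hu)
  have h1 := x.map_iUnion (fun n : ℕ => ⟨Iio (t - 1 / ((n : ℝ) + 1)), measurableSet_Iio⟩) fun n => by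
    apply Iio_subset_Iio
    have : (1 : ℝ) / (((n + 1 : ℕ) : ℝ) + 1) ≤ 1 / ((n : ℝ) + 1) := by gcongr; simp
    linarith
  have h2 : (⟨⋃ n : ℕ, Iio (t - 1 / ((n : ℝ) + 1)), MeasurableSet.iUnion fun n => measurableSet_Iio⟩ :
      BorelSet) = ⟨Iio t, measurableSet_Iio⟩ := Subtype.ext (by
    ext r
    simp only [mem_iUnion, mem_Iio]
    constructor
    · rintro ⟨n, hn⟩
      have : (0 : ℝ) < 1 / ((n : ℝ) + 1) := by positivity
      linarith
    · intro hr
      obtain ⟨n, hn⟩ := exists_nat_one_div_lt (sub_pos.2 hr)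
      exact ⟨n, by linarith⟩)
  rw [resolution, ← h2]
  refine h1.2 ?_
  rintro _ ⟨n, rfl⟩
  refine hw ⟨_, ?_, rfl⟩
  have : (0 : ℝ) < 1 / ((n : ℝ) + 1) := by positivity
  simp only [mem_Iio]
  linarith

/-- An observable is determined by its spectral resolution. -/
theorem resolution_injective : Function.Injective (resolution : Observable E → ℝ → E) := by
  intro x y h
  have key : ∀ A (hA : MeasurableSet A), x.toFun ⟨A, hA⟩ = y.toFun ⟨A, hA⟩ := by
    refine MeasurableSpace.induction_on_inter
      (BorelSpace.measurable_eq.trans (borel_eq_generateFrom_Iio ℝ)) isPiSystem_Iio ?_ ?_ ?_ ?_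
    · rw [toFun_empty, toFun_empty]
    · rintro _ ⟨t, rfl⟩
      exact congrFun h t
    · intro A hA ih
      rw [x.toFun_compl ⟨A, hA⟩, y.toFun_compl ⟨A, hA⟩, ih]
    · intro A hdisj hA ih
      have hm : ∀ n, MeasurableSet (⋃ i < n, A i) := fun n =>
        MeasurableSet.iUnion fun i => MeasurableSet.iUnion fun _ => hA i
      have h0 : ∀ n, x.toFun ⟨⋃ i < n, A i, hm n⟩ = y.toFun ⟨⋃ i < n, A i, hm n⟩ := fun n => by
        induction n with
        | zero =>
          have : (⟨⋃ i < 0, A i, hm 0⟩ : BorelSet) = ⟨∅, MeasurableSet.empty⟩ :=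
            Subtype.ext (by simp)
          rw [this, toFun_empty, toFun_empty]
        | succ n ihn =>
          have h1 : Disjoint (⋃ i < n, A i) (A n) := by
            rw [disjoint_iUnion₂_left]
            exact fun i hi => hdisj hi.ne
          have h2 : (⟨⋃ i < n + 1, A i, hm (n + 1)⟩ : BorelSet) =
              ⟨(⋃ i < n, A i) ∪ A n, (hm n).union (hA n)⟩ := Subtype.ext (biUnion_lt_succ _ n)
          have h3 := x.map_union ⟨_, hm n⟩ ⟨_, hA n⟩ h1
          rw [ihn, ih n, y.map_union ⟨_, hm n⟩ ⟨_, hA n⟩ h1] at h3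
          rw [h2]
          exact (Option.some.inj h3).symm
      have hsub : ∀ n, (⋃ i < n, A i) ⊆ ⋃ i < n + 1, A i := fun n =>
        biUnion_subset_biUnion_left fun i (hi : i < n) => hi.trans (Nat.lt_succ_self n)
      have h1 := x.map_iUnion (fun n => ⟨⋃ i < n, A i, hm n⟩) hsub
      have h2 := y.map_iUnion (fun n => ⟨⋃ i < n, A i, hm n⟩) hsub
      simp only [h0] at h1
      have h3 : (⟨⋃ n, ⋃ i < n, A i, MeasurableSet.iUnion hm⟩ : BorelSet) =
          ⟨⋃ n, A n, MeasurableSet.iUnion hA⟩ := Subtype.ext (by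
        ext r
        simp only [mem_iUnion]
        exact ⟨fun ⟨_, i, _, hi⟩ => ⟨i, hi⟩, fun ⟨i, hi⟩ => ⟨i + 1, i, by omega, hi⟩⟩)
      rw [← h3]
      exact h1.unique h2
  ext A
  exact key A.1 A.2

theorem toFun_Icc_eq_one_iff {a b : ℝ} : x.toFun ⟨Icc a b, measurableSet_Icc⟩ = 1 ↔
    (∀ t ≤ a, x.resolution t = 0) ∧ ∀ t, b < t → x.resolution t = 1 := by
  constructor
  · intro h
    refine ⟨fun t ht => ?_, fun t ht => ?_⟩
    · refine eq_zero_of_le ?_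
      rw [← (x.toFun_compl_eq_zero_iff _).2 h]
      refine x.toFun_mono fun r (hr : r < t) hr2 => ?_
      linarith [hr2.1]
    · refine le_antisymm (le_one _) ?_
      rw [← h]
      exact x.toFun_mono fun r hr => lt_of_le_of_lt hr.2 ht
  · rintro ⟨ha, hb⟩
    rw [← toFun_compl_eq_zero_iff]
    have h1 : ∀ n : ℕ, x.toFun ⟨(Iio (b + 1 / ((n : ℝ) + 1)))ᶜ, measurableSet_Iio.compl⟩ = 0 :=
      fun n => by
        rw [x.toFun_compl_eq_zero_iff ⟨_, measurableSet_Iio⟩]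
        have : (0 : ℝ) < 1 / ((n : ℝ) + 1) := by positivity
        exact hb _ (by linarith)
    have h2 := x.toFun_union_eq_zero (ha a le_rfl) (x.toFun_iUnion_eq_zero h1)
    refine eq_zero_of_le ?_
    rw [← h2]
    refine x.toFun_mono fun r hr => ?_
    by_cases hra : r < a
    · exact Or.inl hra
    · have hbr : b < r := by
        by_contra! h3
        exact hr ⟨not_lt.1 hra, h3⟩
      obtain ⟨n, hn⟩ := exists_nat_one_div_lt (sub_pos.2 hbr)
      refine Or.inr (mem_iUnion.2 ⟨n, ?_⟩)
      simp only [mem_compl_iff, mem_Iio, not_lt]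
      linarith

theorem isBounded_iff : x.IsBounded ↔ ∃ a b, x.toFun ⟨Icc a b, measurableSet_Icc⟩ = 1 := by
  constructor
  · rintro ⟨C, hC, h⟩
    obtain ⟨a, ha⟩ := hC.bddBelow
    obtain ⟨b, hb⟩ := hC.bddAbove
    refine ⟨a, b, le_antisymm (le_one _) ?_⟩
    rw [← h]
    exact x.toFun_mono fun r hr => ⟨ha hr, hb hr⟩
  · rintro ⟨a, b, h⟩
    exact ⟨Icc a b, isCompact_Icc, h⟩

/-- By the Lindelöf property, the complement of the spectrum is a countable union of open sets on
which `x` vanishes. -/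
theorem toFun_spectrum_compl {A : BorelSet} (h : Disjoint A.1 x.spectrum) : x.toFun A = 0 := by
  obtain ⟨T, hT, hTsub, hTU⟩ := TopologicalSpace.isOpen_sUnion_countable
    (compl '' {K : Set ℝ | ∃ hK : IsClosed K, x.toFun ⟨K, hK.measurableSet⟩ = 1}) (by
      rintro _ ⟨K, ⟨hK, -⟩, rfl⟩
      exact hK.isOpen_compl)
  rw [← compl_sInter] at hTU
  obtain ⟨f, hf⟩ := (hT.insert ∅).exists_eq_range (insert_nonempty _ _)
  have hf2 : ∀ n, ∃ hm : MeasurableSet (f n), x.toFun ⟨f n, hm⟩ = 0 := fun n => by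
    have : f n ∈ insert ∅ T := hf ▸ mem_range_self n
    rcases this with h | h
    · exact ⟨h ▸ MeasurableSet.empty, by
        rw [← x.toFun_empty]
        exact congrArg _ (Subtype.ext h)⟩
    · obtain ⟨K, ⟨hK, hK1⟩, hKf⟩ := hTsub h
      refine ⟨hKf ▸ hK.measurableSet.compl, ?_⟩
      rw [← (x.toFun_compl_eq_zero_iff _).2 hK1]
      exact congrArg _ (Subtype.ext hKf.symm)
  choose hm h0 using hf2
  refine eq_zero_of_le ?_
  rw [← x.toFun_iUnion_eq_zero h0]
  refine x.toFun_mono (h.subset_compl_right.trans ?_)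
  change (⋂₀ _)ᶜ ⊆ ⋃ n, f n
  rw [← hTU, ← sUnion_range, ← hf]
  exact sUnion_subset_sUnion (subset_insert _ _)

theorem mem_effectObservables_iff :
    x ∈ effectObservables E ↔ x.toFun ⟨Icc 0 1, measurableSet_Icc⟩ = 1 := by
  constructor
  · intro h
    rw [← toFun_compl_eq_zero_iff]
    exact x.toFun_spectrum_compl (disjoint_compl_left_iff_subset.2 h)
  · intro h
    exact sInter_subset_of_mem ⟨isClosed_Icc, h⟩

/-! ### Infima and suprema through resolutions. -/

section Lattice

variable {T : Set (Observable E)} {S : Set T}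

theorem subtype_antisymm (x y : T) (h : x ≤ y) (h2 : y ≤ x) : x = y :=
  Subtype.ext (resolution_injective (funext fun t => le_antisymm (h2 t) (h t)))

theorem isGLB_unique {m n : T} (h : IsGLB S m) (h2 : IsGLB S n) : m = n :=
  subtype_antisymm m n (h2.2 h.1) (h.2 h2.1)

theorem isLUB_unique {m n : T} (h : IsLUB S m) (h2 : IsLUB S n) : m = n :=
  subtype_antisymm m n (h.2 h2.1) (h2.2 h.1)

theorem isGLB_of_resolution {m : T}
    (h : ∀ t, IsLUB ((fun x : T => x.1.resolution t) '' S) (m.1.resolution t)) : IsGLB S m := by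
  refine ⟨fun x hx t => (h t).1 ⟨x, hx, rfl⟩, fun l hl t => (h t).2 ?_⟩
  rintro _ ⟨x, hx, rfl⟩
  exact hl hx t

/-- The resolution of an upper bound `k` is below `g` pointwise; being left-continuous, it is also
below the left regularization of `g`. -/
theorem isLUB_of_resolution {j : T} {g : ℝ → E}
    (hg : ∀ u, IsGLB ((fun x : T => x.1.resolution u) '' S) (g u))
    (h : ∀ t, IsLUB (g '' Iio t) (j.1.resolution t)) : IsLUB S j := by
  refine ⟨fun x hx t => (h t).2 ?_, fun k hk t => (k.1.isLUB_resolution t).2 ?_⟩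
  · rintro _ ⟨u, hu, rfl⟩
    exact ((hg u).1 ⟨x, hx, rfl⟩).trans (x.1.resolution_mono (le_of_lt hu))
  · rintro _ ⟨u, hu, rfl⟩
    refine le_trans ((hg u).2 ?_) ((h t).1 ⟨u, hu, rfl⟩)
    rintro _ ⟨x, hx, rfl⟩
    exact hk hx u

/-- Suprema commute, so the pointwise supremum is left-continuous. It vanishes up to `a` only if all
members do, but one member suffices to make it `1` beyond `b`. -/
theorem exists_meet (hE : IsSigmaLattice E)
    (hsup : ∀ t, ∃ s, IsLUB ((fun x : T => x.1.resolution t) '' S) s) {a b : ℝ}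
    (ha : ∀ x ∈ S, ∀ t ≤ a, x.1.resolution t = 0)
    (hb : ∃ x ∈ S, ∀ t, b < t → x.1.resolution t = 1) :
    ∃ m : Observable E, m.toFun ⟨Icc a b, measurableSet_Icc⟩ = 1 ∧
      ∀ t, IsLUB ((fun x : T => x.1.resolution t) '' S) (m.resolution t) := by
  choose F hF using hsup
  have ha' : ∀ t ≤ a, F t = 0 := fun t ht => eq_zero_of_le ((hF t).2 (by
    rintro _ ⟨x, hx, rfl⟩
    exact (ha x hx t ht).le))
  have hb' : ∀ t, b < t → F t = 1 := fun t ht => by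
    obtain ⟨x, hx, h⟩ := hb
    exact le_antisymm (le_one _) (h t ht ▸ (hF t).1 ⟨x, hx, rfl⟩)
  have hmono : Monotone F := fun u t hut => (hF u).2 (by
    rintro _ ⟨x, hx, rfl⟩
    exact (x.1.resolution_mono hut).trans ((hF t).1 ⟨x, hx, rfl⟩))
  obtain ⟨m, hm⟩ := hE.exists_observable (F := F) (fun t => by
    refine ⟨?_, fun w hw => (hF t).2 ?_⟩
    · rintro _ ⟨u, hu, rfl⟩
      exact hmono (le_of_lt hu)
    · rintro _ ⟨x, hx, rfl⟩
      refine (x.1.isLUB_resolution t).2 ?_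
      rintro _ ⟨u, hu, rfl⟩
      exact ((hF u).1 ⟨x, hx, rfl⟩).trans (hw ⟨u, hu, rfl⟩)) ha' hb'
  refine ⟨m, ?_, fun t => hm ▸ hF t⟩
  rw [toFun_Icc_eq_one_iff, hm]
  exact ⟨ha', hb'⟩

/-- Pointwise infima may jump, so suprema over `u < t` restore left continuity; by monotonicity they
are suprema of sequences. The roles of `a` and `b` are swapped compared with `exists_meet`. -/
theorem exists_join (hE : IsSigmaLattice E)
    (hinf : ∀ t, ∃ s, IsGLB ((fun x : T => x.1.resolution t) '' S) s) {a b : ℝ}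
    (ha : ∃ x ∈ S, ∀ t ≤ a, x.1.resolution t = 0)
    (hb : ∀ x ∈ S, ∀ t, b < t → x.1.resolution t = 1) :
    ∃ j : Observable E, j.toFun ⟨Icc a b, measurableSet_Icc⟩ = 1 ∧ ∃ g : ℝ → E,
      (∀ u, IsGLB ((fun x : T => x.1.resolution u) '' S) (g u)) ∧
      ∀ t, IsLUB (g '' Iio t) (j.resolution t) := by
  choose g hg using hinf
  have hmono : Monotone g := fun u t hut => (hg t).2 (by
    rintro _ ⟨x, hx, rfl⟩
    exact ((hg u).1 ⟨x, hx, rfl⟩).trans (x.1.resolution_mono hut))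
  have hex : ∀ t, ∃ s, IsLUB (g '' Iio t) s := fun t => by
    obtain ⟨s, hs⟩ := (hE fun n : ℕ => g (t - 1 / ((n : ℝ) + 1))).1
    refine ⟨s, ?_, fun w hw => hs.2 ?_⟩
    · rintro _ ⟨u, hu, rfl⟩
      obtain ⟨n, hn⟩ := exists_nat_one_div_lt (sub_pos.2 (mem_Iio.1 hu))
      exact (hmono (by linarith)).trans (hs.1 ⟨n, rfl⟩)
    · rintro _ ⟨n, rfl⟩
      have : (0 : ℝ) < 1 / ((n : ℝ) + 1) := by positivity
      exact hw ⟨_, by simp only [mem_Iio]; linarith, rfl⟩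
  choose F hF using hex
  have ha' : ∀ t ≤ a, F t = 0 := fun t ht => eq_zero_of_le ((hF t).2 (by
    rintro _ ⟨u, hu, rfl⟩
    obtain ⟨x, hx, h⟩ := ha
    rw [← h u ((le_of_lt hu).trans ht)]
    exact (hg u).1 ⟨x, hx, rfl⟩))
  have hb' : ∀ t, b < t → F t = 1 := fun t ht => by
    obtain ⟨u, hbu, hut⟩ := exists_between ht
    refine le_antisymm (le_one _) (le_trans ((hg u).2 ?_) ((hF t).1 ⟨u, hut, rfl⟩))
    rintro _ ⟨x, hx, rfl⟩
    exact (hb x hx u hbu).ge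
  obtain ⟨j, hj⟩ := hE.exists_observable (F := F) (fun t => by
    refine ⟨?_, fun w hw => (hF t).2 ?_⟩
    · rintro _ ⟨u, hu, rfl⟩
      refine (hF u).2 ?_
      rintro _ ⟨v, hv, rfl⟩
      exact (hF t).1 ⟨v, (mem_Iio.1 hv).trans hu, rfl⟩
    · rintro _ ⟨u, hu, rfl⟩
      obtain ⟨v, huv, hvt⟩ := exists_between (mem_Iio.1 hu)
      exact ((hF v).1 ⟨u, huv, rfl⟩).trans (hw ⟨v, hvt, rfl⟩)) ha' hb'
  refine ⟨j, ?_, g, hg, fun t => hj ▸ hF t⟩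
  rw [toFun_Icc_eq_one_iff, hj]
  exact ⟨ha', hb'⟩

end Lattice

/-! ### Bounded observables. -/

section Bounded

variable {S : Set (boundedObservables E)}

theorem exists_bounds (y : boundedObservables E) : ∃ a b,
    (∀ t ≤ a, y.1.resolution t = 0) ∧ ∀ t, b < t → y.1.resolution t = 1 := by
  obtain ⟨a, b, h⟩ := y.1.isBounded_iff.1 y.2
  exact ⟨a, b, y.1.toFun_Icc_eq_one_iff.1 h⟩

theorem exists_bounded_meet (hE : IsSigmaLattice E) (hne : S.Nonempty) (hc : S.Countable) {a : ℝ}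
    (ha : ∀ x ∈ S, ∀ t ≤ a, x.1.resolution t = 0) : ∃ m : boundedObservables E,
      ∀ t, IsLUB ((fun x : boundedObservables E => x.1.resolution t) '' S) (m.1.resolution t) := by
  obtain ⟨y, hy⟩ := hne
  obtain ⟨_, b, -, hb⟩ := exists_bounds y
  obtain ⟨m, hm, h⟩ := exists_meet hE
    (fun t => (hE.exists_of_countable (hc.image _) ⟨_, y, hy, rfl⟩).1) ha ⟨y, hy, hb⟩
  exact ⟨⟨m, m.isBounded_iff.2 ⟨a, b, hm⟩⟩, h⟩

theorem exists_bounded_join (hE : IsSigmaLattice E) (hne : S.Nonempty) (hc : S.Countable) {b : ℝ}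
    (hb : ∀ x ∈ S, ∀ t, b < t → x.1.resolution t = 1) : ∃ j : boundedObservables E, ∃ g : ℝ → E,
      (∀ u, IsGLB ((fun x : boundedObservables E => x.1.resolution u) '' S) (g u)) ∧
      ∀ t, IsLUB (g '' Iio t) (j.1.resolution t) := by
  obtain ⟨y, hy⟩ := hne
  obtain ⟨a, _, ha, -⟩ := exists_bounds y
  obtain ⟨j, hj, h⟩ := exists_join hE
    (fun t => (hE.exists_of_countable (hc.image _) ⟨_, y, hy, rfl⟩).2) ⟨y, hy, ha⟩ hb
  exact ⟨⟨j, j.isBounded_iff.2 ⟨a, b, hj⟩⟩, h⟩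

theorem exists_meet_of_bddBelow (hE : IsSigmaLattice E) (hne : S.Nonempty) (hc : S.Countable)
    (hS : BddBelow S) : ∃ m : boundedObservables E,
      ∀ t, IsLUB ((fun x : boundedObservables E => x.1.resolution t) '' S) (m.1.resolution t) := by
  obtain ⟨l, hl⟩ := hS
  obtain ⟨a, _, ha, -⟩ := exists_bounds l
  exact exists_bounded_meet hE hne hc fun x hx t ht => eq_zero_of_le (ha t ht ▸ hl hx t)

theorem exists_join_of_bddAbove (hE : IsSigmaLattice E) (hne : S.Nonempty) (hc : S.Countable)
    (hS : BddAbove S) : ∃ j : boundedObservables E, ∃ g : ℝ → E,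
      (∀ u, IsGLB ((fun x : boundedObservables E => x.1.resolution u) '' S) (g u)) ∧
      ∀ t, IsLUB (g '' Iio t) (j.1.resolution t) := by
  obtain ⟨l, hl⟩ := hS
  obtain ⟨_, b, -, hb⟩ := exists_bounds l
  exact exists_bounded_join hE hne hc fun x hx t ht =>
    le_antisymm (le_one _) (hb t ht ▸ hl hx t)

theorem isDedekindSigmaCompleteLattice_bounded (hE : IsSigmaLattice E) :
    IsDedekindSigmaCompleteLattice (boundedObservables E) := by
  refine ⟨⟨subtype_antisymm, fun x y => ⟨?_, ?_⟩⟩, fun S hne hc hS => ?_, fun S hne hc hS => ?_⟩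
  · obtain ⟨_, b, -, hb⟩ := exists_bounds x
    obtain ⟨_, b', -, hb'⟩ := exists_bounds y
    obtain ⟨j, g, hg, h⟩ := exists_bounded_join (S := {x, y}) (b := max b b') hE (by simp)
      (by simp) (by
        rintro z (rfl | rfl) t ht
        · exact hb t (lt_of_le_of_lt (le_max_left _ _) ht)
        · exact hb' t (lt_of_le_of_lt (le_max_right _ _) ht))
    exact ⟨j, isLUB_of_resolution hg h⟩
  · obtain ⟨a, _, ha, -⟩ := exists_bounds x
    obtain ⟨a', _, ha', -⟩ := exists_bounds y
    obtain ⟨m, h⟩ := exists_bounded_meet (S := {x, y}) (a := min a a') hE (by simp)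
      (by simp) (by
        rintro z (rfl | rfl) t ht
        · exact ha t (ht.trans (min_le_left _ _))
        · exact ha' t (ht.trans (min_le_right _ _)))
    exact ⟨m, isGLB_of_resolution h⟩
  · obtain ⟨m, h⟩ := exists_meet_of_bddBelow hE hne hc hS
    exact ⟨m, isGLB_of_resolution h⟩
  · obtain ⟨j, g, hg, h⟩ := exists_join_of_bddAbove hE hne hc hS
    exact ⟨j, isLUB_of_resolution hg h⟩

end Bounded

/-! ### Observables with spectrum in the unit interval. -/

section Effects

theorem question_mem_effectObservables (a : E) : question a ∈ effectObservables E := by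
  rw [mem_effectObservables_iff]
  simp [question, questionFun]

theorem isLeast_question_zero : IsLeast (effectObservables E) (question 0) := by
  refine ⟨question_mem_effectObservables 0, fun y hy t => ?_⟩
  rw [mem_effectObservables_iff, toFun_Icc_eq_one_iff] at hy
  by_cases ht : t ≤ 0
  · rw [hy.1 t ht]
    exact EffectAlgebra.zero_le _
  · have : (question (0 : E)).resolution t = 1 := by
      simp [resolution, question, questionFun, not_le.1 ht, compl_zero]
    rw [this]
    exact le_one _

theorem isGreatest_question_one : IsGreatest (effectObservables E) (question 1) := by
  refine ⟨question_mem_effectObservables 1, fun y hy t => ?_⟩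
  rw [mem_effectObservables_iff, toFun_Icc_eq_one_iff] at hy
  by_cases ht : 1 < t
  · rw [hy.2 t ht]
    exact le_one _
  · have : (question (1 : E)).resolution t = 0 := by
      simp [resolution, question, questionFun, ht, compl_one]
    rw [this]
    exact EffectAlgebra.zero_le _

theorem effect_bounds (y : effectObservables E) :
    (∀ t ≤ 0, y.1.resolution t = 0) ∧ ∀ t, 1 < t → y.1.resolution t = 1 :=
  y.1.toFun_Icc_eq_one_iff.1 (y.1.mem_effectObservables_iff.1 y.2)

theorem exists_effect_isLUB (hE : IsSigmaLattice E) {S : Set (effectObservables E)}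
    (h : S.Nonempty → ∀ t, ∃ s, IsGLB ((fun x : effectObservables E => x.1.resolution t) '' S) s) :
    ∃ j, IsLUB S j := by
  rcases S.eq_empty_or_nonempty with rfl | hne
  · exact ⟨⟨question 0, isLeast_question_zero.1⟩, isLUB_empty_iff.2 fun y =>
      isLeast_question_zero.2 y.2⟩
  · obtain ⟨y, hy⟩ := id hne
    obtain ⟨j, hj, g, hg, hgj⟩ := exists_join hE (h hne) ⟨y, hy, (effect_bounds y).1⟩
      fun x _ => (effect_bounds x).2
    exact ⟨⟨j, j.mem_effectObservables_iff.2 hj⟩, isLUB_of_resolution hg hgj⟩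

theorem exists_effect_isGLB (hE : IsSigmaLattice E) {S : Set (effectObservables E)}
    (h : S.Nonempty → ∀ t, ∃ s, IsLUB ((fun x : effectObservables E => x.1.resolution t) '' S) s) :
    ∃ m, IsGLB S m := by
  rcases S.eq_empty_or_nonempty with rfl | hne
  · exact ⟨⟨question 1, isGreatest_question_one.1⟩, isGLB_empty_iff.2 fun y =>
      isGreatest_question_one.2 y.2⟩
  · obtain ⟨y, hy⟩ := id hne
    obtain ⟨m, hm, hm2⟩ := exists_meet hE (h hne) (fun x _ => (effect_bounds x).1)
      ⟨y, hy, (effect_bounds y).2⟩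
    exact ⟨⟨m, m.mem_effectObservables_iff.2 hm⟩, isGLB_of_resolution hm2⟩

theorem isSigmaCompleteLattice_effect (hE : IsSigmaLattice E) :
    IsSigmaCompleteLattice (effectObservables E) := by
  have key : ∀ S : Set (effectObservables E), S.Countable → (∃ s, IsLUB S s) ∧ ∃ i, IsGLB S i :=
    fun S hS =>
      ⟨exists_effect_isLUB hE fun hne t =>
        (hE.exists_of_countable (hS.image _) (hne.image _)).2,
      exists_effect_isGLB hE fun hne t =>
        (hE.exists_of_countable (hS.image _) (hne.image _)).1⟩
  exact ⟨⟨subtype_antisymm, fun x y => key {x, y} (by simp)⟩, key⟩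

theorem isCompleteLatticeOrder_effect (hE : IsSigmaLattice E) (h : IsCompleteLatticeOrder E) :
    IsCompleteLatticeOrder (effectObservables E) := by
  have key : ∀ S : Set (effectObservables E), (∃ s, IsLUB S s) ∧ ∃ i, IsGLB S i := fun S =>
    ⟨exists_effect_isLUB hE fun _ _ => (h.2 _).2, exists_effect_isGLB hE fun _ _ => (h.2 _).1⟩
  exact ⟨⟨subtype_antisymm, fun x y => key {x, y}⟩, key⟩

end Effects

end Observable

theorem theorem3p7 (E : Type*) [EffectAlgebra E] (hE : EffectAlgebra.IsSigmaLattice E) :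
    -- the bounded observables form a Dedekind sigma-complete lattice
    IsDedekindSigmaCompleteLattice (boundedObservables E) ∧
    -- formula for countable meets
    (∀ S : Set (boundedObservables E), S.Nonempty → S.Countable →
      ∀ m : boundedObservables E, IsGLB S m ↔
        ∀ t : ℝ, IsLUB ((fun x : boundedObservables E => x.1.resolution t) '' S)
          (m.1.resolution t)) ∧
    -- formula for countable joins
    (∀ S : Set (boundedObservables E), S.Nonempty → S.Countable →
      ∀ j : boundedObservables E, IsLUB S j ↔
        ∃ g : ℝ → E,
          (∀ u : ℝ, IsGLB ((fun x : boundedObservables E => x.1.resolution u) '' S) (g u)) ∧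
          ∀ t : ℝ, IsLUB (g '' Set.Iio t) (j.1.resolution t)) ∧
    -- the observables with spectrum in the unit interval
    IsSigmaCompleteLattice (effectObservables E) ∧
    (IsCompleteLatticeOrder E → IsCompleteLatticeOrder (effectObservables E)) ∧
    IsLeast (effectObservables E) (Observable.question 0) ∧
    IsGreatest (effectObservables E) (Observable.question 1) := by
  refine ⟨isDedekindSigmaCompleteLattice_bounded hE, fun S hne hc m =>
    ⟨fun hm => ?_, isGLB_of_resolution⟩, fun S hne hc j => ⟨fun hj => ?_, ?_⟩,
    isSigmaCompleteLattice_effect hE, isCompleteLatticeOrder_effect hE, isLeast_question_zero,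
    isGreatest_question_one⟩
  -- The given infimum is itself a lower bound, so the infimum built from the formula exists;
  -- uniqueness identifies the two.
  · obtain ⟨n, hn⟩ := exists_meet_of_bddBelow hE hne hc ⟨m, hm.1⟩
    rw [isGLB_unique hm (isGLB_of_resolution hn)]
    exact hn
  · obtain ⟨k, g, hg, hk⟩ := exists_join_of_bddAbove hE hne hc ⟨j, hj.1⟩
    rw [isLUB_unique hj (isLUB_of_resolution hg hk)]
    exact ⟨g, hg, hk⟩
  · rintro ⟨g, hg, h⟩
    exact isLUB_of_resolution hg h
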